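/- Let $S^1=\mathbb R/2\pi\mathbb Z$ and let $\varphi:\mathbb R\times S^1\to\mathbb R$ be smooth. Suppose that for some $R$ the value $\varphi(x,y)$ does not depend on $x$ for $x>R$, nor for $x<-R$ (for instance, $\varphi$ is constant for large $|x|$). Let $\Omega_+=\{x>0\}$, $\Omega_-=\{x<0\}$ and $\Omega=\{x\neq 0\}$, as subsets of $\mathbb R\times S^1$. Let $D\in\{\Omega_+,\Omega_-,\Omega\}$ carry the Riemannian metric $g=\mathrm{diag}(1,x^{-2}e^{-2\varphi(x,y)})$, with Riemannian volume $\omega$, Gaussian curvature $K$ and Laplace–Beltrami operator $\Delta=\mathrm{div}_\omega\circ\mathrm{grad}_g$. Let $c\in(0,1/2)$. Let $A=-\Delta+cK$ be the operator on the complex Hilbert space $L^2(D,\omega)$ with domain $C_0^\infty(D)$. Write $A^*$ for its adjoint and $\overline A$ for its closure. Let $D'\in\{\Omega_+,\Omega_-,\Omega\}$ with $D'\subseteq D$. For every $\varepsilon>0$ there are two functions $h_{+},h_{-}\in L^2(D,\omega)\cap C^\infty(D)$ (depending on $\varphi,D,D',\varepsilon,c$) such that 1. $h_{\pm}\in\mathcal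 D(A^*)$; 2. $h_{\pm}\notin\mathcal D(\overline A)$, and moreover $h_+,h_-$ are linearly independent modulo $\mathcal D(\overline A)$; 3. the support of $h_\pm$ in $D$ is contained in $D'\cap\{|x|<\varepsilon\}$ (for $D'=\Omega_+$ this is $(0,\varepsilon)\times S^1$, and for $D'=\Omega_-$ it is $(-\varepsilon,0)\times S^1$). In particular $A$ is not essentially self-adjoint, that is, $\overline A$ is not self-adjoint. -/

import Mathlib

open Set Filter Topology MeasureTheory
open scoped ContDiff

noncomputable section

namespace Grushin

instance factTwoPiPos : Fact ((0 : ℝ) < 2 * Real.pi) := ⟨Real.two_pi_pos⟩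

/-- The cylinder `ℝ × S¹` with `S¹ = ℝ / 2πℤ`. -/
abbrev Cylinder : Type := ℝ × AddCircle (2 * Real.pi)

/-- The covering map `ℝ × ℝ → ℝ × S¹`. -/
def cover (q : ℝ × ℝ) : Cylinder := (q.1, (q.2 : AddCircle (2 * Real.pi)))

/-- `f` is smooth (`C^∞`) on `Ω ⊆ ℝ × S¹`, i.e. its lift to the universal cover `ℝ × ℝ` is smooth
on the preimage of `Ω`. -/
def SmoothOn {E : Type*} [NormedAddCommGroup E] [NormedSpace ℝ E]
    (Ω : Set Cylinder) (f : Cylinder → E) : Prop :=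
  ContDiffOn ℝ ∞ (f ∘ cover) (cover ⁻¹' Ω)

/-- The partial derivatives on the cylinder: `pd 0 = ∂/∂x` and `pd 1 = ∂/∂y`. -/
def pd {E : Type*} [NormedAddCommGroup E] [NormedSpace ℝ E]
    (i : Fin 2) (f : Cylinder → E) (p : Cylinder) : E :=
  match i with
  | 0 => deriv (fun t : ℝ => f (p.1 + t, p.2)) 0
  | 1 => deriv (fun t : ℝ => f (p.1, p.2 + (t : AddCircle (2 * Real.pi)))) 0

/-- A (smooth) Riemannian metric on `Ω ⊆ ℝ × S¹`, given by its matrix in the coordinates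
`(x, y)`. -/
structure RiemannianMetric (Ω : Set Cylinder) where
  /-- the coefficients `g_{ij}` -/
  coeff : Cylinder → Matrix (Fin 2) (Fin 2) ℝ
  smooth : ∀ i j, SmoothOn Ω (fun p => coeff p i j)
  posDef : ∀ p ∈ Ω, (coeff p).PosDef

namespace RiemannianMetric

variable {Ω : Set Cylinder} (g : RiemannianMetric Ω)

/-- The coefficients `g^{ij}` of the inverse metric. -/
def inv (i j : Fin 2) (p : Cylinder) : ℝ := (g.coeff p)⁻¹ i j

/-- The density `√(det g)` of the Riemannian volume form with respect to `dx dy`. -/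
def volDensity (p : Cylinder) : ℝ := √((g.coeff p).det)

/-- The Riemannian volume `ω = √(det g) dx dy` on `Ω`. -/
def vol : Measure Cylinder :=
  (volume.restrict Ω).withDensity (fun p => ENNReal.ofReal (g.volDensity p))

/-- The gradient: `(grad u)^i = ∑_j g^{ij} ∂_j u`. -/
def grad (u : Cylinder → ℂ) (i : Fin 2) (p : Cylinder) : ℂ := ∑ j, g.inv i j p • pd j u p

/-- The divergence with respect to the Riemannian volume:
`div X = (1 / √(det g)) ∑_i ∂_i (√(det g) X^i)`. -/
def div (X : Fin 2 → Cylinder → ℂ) (p : Cylinder) : ℂ :=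
  (g.volDensity p)⁻¹ • ∑ i, pd i (fun q => g.volDensity q • X i q) p

/-- The Laplace–Beltrami operator `Δ = div ∘ grad`. -/
def laplaceBeltrami (u : Cylinder → ℂ) : Cylinder → ℂ := g.div (g.grad u)

/-- The Christoffel symbols
`Γ^k_{ij} = ½ ∑_l g^{kl} (∂_i g_{jl} + ∂_j g_{il} - ∂_l g_{ij})`. -/
def christoffel (k i j : Fin 2) (p : Cylinder) : ℝ :=
  (1 / 2) * ∑ l, g.inv k l p *
    (pd i (fun q => g.coeff q j l) p + pd j (fun q => g.coeff q i l) p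
      - pd l (fun q => g.coeff q i j) p)

/-- The `l`-th component of `R(∂_i, ∂_j) ∂_k`, where
`R(X, Y) Z = ∇_X ∇_Y Z - ∇_Y ∇_X Z - ∇_{[X,Y]} Z` is the Riemann curvature tensor. -/
def riemann (l k i j : Fin 2) (p : Cylinder) : ℝ :=
  pd i (g.christoffel l j k) p - pd j (g.christoffel l i k) p
    + ∑ m, (g.christoffel l i m p * g.christoffel m j k p
        - g.christoffel l j m p * g.christoffel m i k p)

/-- The Gaussian curvature `K = g(R(∂_x, ∂_y) ∂_y, ∂_x) / det g`. -/
def gaussCurvature (p : Cylinder) : ℝ :=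
  (∑ l, g.coeff p 0 l * g.riemann l 1 0 1 p) / (g.coeff p).det

/-- The differential expression `-Δ u + c K u`. -/
def curvatureLaplacianExpr (c : ℝ) (u : Cylinder → ℂ) (p : Cylinder) : ℂ :=
  -g.laplaceBeltrami u p + (c * g.gaussCurvature p) • u p

end RiemannianMetric

/-! ### Calculus of smooth functions on open subsets of the cylinder -/

section Smooth

variable {E F : Type*} [NormedAddCommGroup E] [NormedSpace ℝ E]
  [NormedAddCommGroup F] [NormedSpace ℝ F] {Ω : Set Cylinder}

theorem continuous_cover : Continuous cover :=
  continuous_fst.prodMk ((AddCircle.continuous_mk' _).comp continuous_snd)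

theorem isOpenMap_cover : IsOpenMap cover :=
  IsOpenMap.prodMap IsOpenMap.id QuotientAddGroup.isOpenMap_coe

theorem cover_surjective : Function.Surjective cover := by
  rintro ⟨x, y⟩
  obtain ⟨t, rfl⟩ := QuotientAddGroup.mk_surjective y
  exact ⟨(x, t), rfl⟩

theorem SmoothOn.mono {Ω' : Set Cylinder} {f : Cylinder → E} (hf : SmoothOn Ω f) (h : Ω' ⊆ Ω) :
    SmoothOn Ω' f := ContDiffOn.mono hf (preimage_mono h)

theorem SmoothOn.continuousOn (hΩ : IsOpen Ω) {f : Cylinder → E} (hf : SmoothOn Ω f) :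
    ContinuousOn f Ω := by
  intro p hp
  obtain ⟨q, rfl⟩ := cover_surjective p
  have h1 : ContinuousAt (f ∘ cover) q :=
    (ContDiffOn.continuousOn hf).continuousAt
      ((hΩ.preimage continuous_cover).mem_nhds hp)
  have h2 : map cover (𝓝 q) = 𝓝 (cover q) :=
    (isOpenMap_cover.nhds_le q).antisymm' continuous_cover.continuousAt
  refine ContinuousAt.continuousWithinAt ?_
  rw [ContinuousAt, ← h2, tendsto_map'_iff]
  exact h1

theorem pd_zero_cover (f : Cylinder → E) (q : ℝ × ℝ)
    (hf : DifferentiableAt ℝ (f ∘ cover) q) :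
    HasDerivAt (fun t : ℝ => f ((cover q).1 + t, (cover q).2))
      (fderiv ℝ (f ∘ cover) q (1, 0)) 0 := by
  have h1 : HasDerivAt (fun t : ℝ => (q.1 + t, q.2)) ((1 : ℝ), (0 : ℝ)) 0 :=
    ((hasDerivAt_id (0 : ℝ)).const_add q.1).prodMk (hasDerivAt_const _ _)
  have h2 : HasFDerivAt (f ∘ cover) (fderiv ℝ (f ∘ cover) q)
      ((fun t : ℝ => (q.1 + t, q.2)) 0) := by
    simpa using hf.hasFDerivAt
  exact h2.comp_hasDerivAt (0 : ℝ) h1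

theorem pd_one_cover (f : Cylinder → E) (q : ℝ × ℝ)
    (hf : DifferentiableAt ℝ (f ∘ cover) q) :
    HasDerivAt (fun t : ℝ => f ((cover q).1, (cover q).2 + (t : AddCircle (2 * Real.pi))))
      (fderiv ℝ (f ∘ cover) q (0, 1)) 0 := by
  have h1 : HasDerivAt (fun t : ℝ => (q.1, q.2 + t)) ((0 : ℝ), (1 : ℝ)) 0 :=
    (hasDerivAt_const _ _).prodMk ((hasDerivAt_id (0 : ℝ)).const_add q.2)
  have h2 : HasFDerivAt (f ∘ cover) (fderiv ℝ (f ∘ cover) q)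
      ((fun t : ℝ => (q.1, q.2 + t)) 0) := by
    simpa using hf.hasFDerivAt
  exact h2.comp_hasDerivAt (0 : ℝ) h1

/-- The coordinate directions. -/
def dir (i : Fin 2) : ℝ × ℝ :=
  match i with
  | 0 => (1, 0)
  | 1 => (0, 1)

theorem pd_cover (i : Fin 2) (f : Cylinder → E) (q : ℝ × ℝ)
    (hf : DifferentiableAt ℝ (f ∘ cover) q) :
    pd i f (cover q) = fderiv ℝ (f ∘ cover) q (dir i) := by
  fin_cases i
  · exact (pd_zero_cover f q hf).deriv
  · exact (pd_one_cover f q hf).deriv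

theorem SmoothOn.differentiableAt (hΩ : IsOpen Ω) {f : Cylinder → E} (hf : SmoothOn Ω f)
    {q : ℝ × ℝ} (hq : cover q ∈ Ω) : DifferentiableAt ℝ (f ∘ cover) q :=
  (ContDiffOn.contDiffAt hf ((hΩ.preimage continuous_cover).mem_nhds hq)).differentiableAt
    (by simp)

theorem SmoothOn.pd (hΩ : IsOpen Ω) {f : Cylinder → E} (hf : SmoothOn Ω f) (i : Fin 2) :
    SmoothOn Ω (pd i f) := by
  have h1 : ContDiffOn ℝ ∞ (fderiv ℝ (f ∘ cover)) (cover ⁻¹' Ω) :=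
    ContDiffOn.fderiv_of_isOpen hf (hΩ.preimage continuous_cover) (by simp)
  have h2 : ContDiffOn ℝ ∞ (fun q => fderiv ℝ (f ∘ cover) q (dir i)) (cover ⁻¹' Ω) :=
    h1.clm_apply contDiffOn_const
  exact h2.congr fun q hq => pd_cover i f q (hf.differentiableAt hΩ hq)

theorem SmoothOn.const (a : E) : SmoothOn Ω (fun _ => a) := contDiffOn_const

theorem SmoothOn.add {f h : Cylinder → E} (hf : SmoothOn Ω f) (hh : SmoothOn Ω h) :
    SmoothOn Ω (fun p => f p + h p) := ContDiffOn.add hf hh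

theorem SmoothOn.sub {f h : Cylinder → E} (hf : SmoothOn Ω f) (hh : SmoothOn Ω h) :
    SmoothOn Ω (fun p => f p - h p) := ContDiffOn.sub hf hh

theorem SmoothOn.neg {f : Cylinder → E} (hf : SmoothOn Ω f) :
    SmoothOn Ω (fun p => -f p) := ContDiffOn.neg hf

theorem SmoothOn.smul {a : Cylinder → ℝ} {f : Cylinder → E} (ha : SmoothOn Ω a)
    (hf : SmoothOn Ω f) : SmoothOn Ω (fun p => a p • f p) := ContDiffOn.smul ha hf

theorem SmoothOn.mul {a b : Cylinder → ℝ} (ha : SmoothOn Ω a) (hb : SmoothOn Ω b) :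
    SmoothOn Ω (fun p => a p * b p) := ContDiffOn.mul ha hb

theorem SmoothOn.inv {a : Cylinder → ℝ} (ha : SmoothOn Ω a) (h0 : ∀ p ∈ Ω, a p ≠ 0) :
    SmoothOn Ω (fun p => (a p)⁻¹) := ContDiffOn.inv ha fun _ hq => h0 _ hq

theorem SmoothOn.sum {ι : Type*} {s : Finset ι} {f : ι → Cylinder → E}
    (hf : ∀ i ∈ s, SmoothOn Ω (f i)) : SmoothOn Ω (fun p => ∑ i ∈ s, f i p) :=
  ContDiffOn.sum hf

theorem pd_add (hΩ : IsOpen Ω) {f h : Cylinder → E} (hf : SmoothOn Ω f) (hh : SmoothOn Ω h)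
    (i : Fin 2) {p : Cylinder} (hp : p ∈ Ω) :
    Grushin.pd i (fun q => f q + h q) p = Grushin.pd i f p + Grushin.pd i h p := by
  obtain ⟨q, rfl⟩ := cover_surjective p
  have h1 := hf.differentiableAt hΩ hp
  have h2 := hh.differentiableAt hΩ hp
  rw [pd_cover i _ q h1, pd_cover i _ q h2,
    pd_cover i _ q ((hf.add hh).differentiableAt hΩ hp)]
  exact congrArg (fun L => L (dir i)) (fderiv_add h1 h2)

theorem pd_const_smul (hΩ : IsOpen Ω) {f : Cylinder → ℂ} (hf : SmoothOn Ω f) (a : ℂ)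
    (i : Fin 2) {p : Cylinder} (hp : p ∈ Ω) :
    Grushin.pd i (fun q => a * f q) p = a * Grushin.pd i f p := by
  obtain ⟨q, rfl⟩ := cover_surjective p
  have h1 := hf.differentiableAt hΩ hp
  have h2 : DifferentiableAt ℝ ((fun p => a * f p) ∘ cover) q := h1.const_mul a
  rw [pd_cover i _ q h1, pd_cover i _ q h2]
  exact congrArg (fun L => L (dir i)) (fderiv_const_mul h1 a)

theorem pd_congr (i : Fin 2) {f h : Cylinder → E} {p : Cylinder} (hfh : f =ᶠ[𝓝 p] h) :
    Grushin.pd i f p = Grushin.pd i h p := by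
  fin_cases i
  · refine EventuallyEq.deriv_eq (f₁ := fun t : ℝ => f (p.1 + t, p.2)) ?_
    have : Tendsto (fun t : ℝ => ((p.1 + t, p.2) : Cylinder)) (𝓝 0) (𝓝 p) := by
      have : Continuous (fun t : ℝ => ((p.1 + t, p.2) : Cylinder)) := by fun_prop
      simpa using this.tendsto 0
    exact this.eventually hfh
  · refine EventuallyEq.deriv_eq
      (f₁ := fun t : ℝ => f (p.1, p.2 + (t : AddCircle (2 * Real.pi)))) ?_
    have : Tendsto (fun t : ℝ => ((p.1, p.2 + (t : AddCircle (2 * Real.pi))) : Cylinder))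
        (𝓝 0) (𝓝 p) := by
      have : Continuous
          (fun t : ℝ => ((p.1, p.2 + (t : AddCircle (2 * Real.pi))) : Cylinder)) :=
        continuous_const.prodMk (continuous_const.add (AddCircle.continuous_mk' _))
      simpa using this.tendsto 0
    exact this.eventually hfh

theorem pd_zero_fun (i : Fin 2) (p : Cylinder) : Grushin.pd i (fun _ => (0 : E)) p = 0 := by
  fin_cases i <;> simp [Grushin.pd]

theorem tsupport_pd_subset (i : Fin 2) (f : Cylinder → E) :
    tsupport (Grushin.pd i f) ⊆ tsupport f := by
  refine closure_minimal (fun p hp => ?_) (isClosed_tsupport f)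
  by_contra h
  exact hp ((pd_congr i (notMem_tsupport_iff_eventuallyEq.mp h)).trans (pd_zero_fun i p))

end Smooth

/-! ### The curvature Laplacian as an unbounded operator on `L²(Ω, ω)` -/

/-- The space `C_0^∞(Ω)` of smooth complex functions with compact support contained in `Ω`
(extended by zero to the cylinder). -/
def testFunctions (Ω : Set Cylinder) : Submodule ℂ (Cylinder → ℂ) where
  carrier := {u | SmoothOn univ u ∧ HasCompactSupport u ∧ tsupport u ⊆ Ω}
  zero_mem' := ⟨SmoothOn.const 0, HasCompactSupport.zero, by simp [tsupport]⟩
  add_mem' := fun hu hv => ⟨hu.1.add hv.1, hu.2.1.add hv.2.1,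
    (tsupport_add _ _).trans (union_subset hu.2.2 hv.2.2)⟩
  smul_mem' := fun a u hu => ⟨ContDiffOn.const_smul a hu.1,
    hu.2.1.mono' ((Function.support_const_smul_subset a u).trans subset_closure),
    (closure_mono (Function.support_const_smul_subset a u)).trans hu.2.2⟩

namespace RiemannianMetric

variable {Ω : Set Cylinder} (g : RiemannianMetric Ω)

theorem det_pos {p : Cylinder} (hp : p ∈ Ω) : 0 < (g.coeff p).det := (g.posDef p hp).det_pos

theorem volDensity_pos {p : Cylinder} (hp : p ∈ Ω) : 0 < g.volDensity p :=
  Real.sqrt_pos.mpr (g.det_pos hp)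

theorem smoothOn_det : SmoothOn Ω (fun p => (g.coeff p).det) := by
  simp only [Matrix.det_fin_two]
  exact ((g.smooth 0 0).mul (g.smooth 1 1)).sub ((g.smooth 0 1).mul (g.smooth 1 0))

theorem smoothOn_volDensity : SmoothOn Ω g.volDensity :=
  ContDiffOn.sqrt g.smoothOn_det fun _ hq => (g.det_pos hq).ne'

theorem smoothOn_inv (i j : Fin 2) : SmoothOn Ω (g.inv i j) := by
  have h : g.inv i j = fun p => ((g.coeff p).det)⁻¹ * (g.coeff p).adjugate i j := by
    funext p
    simp [inv, Matrix.inv_def]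
  rw [h]
  refine (g.smoothOn_det.inv fun _ hp => (g.det_pos hp).ne').mul ?_
  fin_cases i <;> fin_cases j <;> simp only [Matrix.adjugate_fin_two]
  · exact g.smooth 1 1
  · exact (g.smooth 0 1).neg
  · exact (g.smooth 1 0).neg
  · exact g.smooth 0 0

theorem smoothOn_christoffel (hΩ : IsOpen Ω) (k i j : Fin 2) :
    SmoothOn Ω (g.christoffel k i j) :=
  (SmoothOn.const _).mul <| SmoothOn.sum fun _ _ => (g.smoothOn_inv _ _).mul
    ((((g.smooth _ _).pd hΩ _).add ((g.smooth _ _).pd hΩ _)).sub ((g.smooth _ _).pd hΩ _))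

theorem smoothOn_riemann (hΩ : IsOpen Ω) (l k i j : Fin 2) :
    SmoothOn Ω (g.riemann l k i j) :=
  (((g.smoothOn_christoffel hΩ _ _ _).pd hΩ _).sub
    ((g.smoothOn_christoffel hΩ _ _ _).pd hΩ _)).add <| SmoothOn.sum fun _ _ =>
    ((g.smoothOn_christoffel hΩ _ _ _).mul (g.smoothOn_christoffel hΩ _ _ _)).sub
      ((g.smoothOn_christoffel hΩ _ _ _).mul (g.smoothOn_christoffel hΩ _ _ _))

theorem smoothOn_gaussCurvature (hΩ : IsOpen Ω) : SmoothOn Ω g.gaussCurvature := by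
  have h : g.gaussCurvature = fun p =>
      (∑ l, g.coeff p 0 l * g.riemann l 1 0 1 p) * ((g.coeff p).det)⁻¹ := by
    funext p
    rw [gaussCurvature, div_eq_mul_inv]
  rw [h]
  exact (SmoothOn.sum fun _ _ => (g.smooth _ _).mul (g.smoothOn_riemann hΩ _ _ _ _)).mul
    (g.smoothOn_det.inv fun _ hp => (g.det_pos hp).ne')

theorem smoothOn_grad (hΩ : IsOpen Ω) {u : Cylinder → ℂ} (hu : SmoothOn Ω u) (i : Fin 2) :
    SmoothOn Ω (g.grad u i) :=
  SmoothOn.sum fun _ _ => (g.smoothOn_inv _ _).smul (hu.pd hΩ _)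

theorem smoothOn_flux (hΩ : IsOpen Ω) {u : Cylinder → ℂ} (hu : SmoothOn Ω u) (i : Fin 2) :
    SmoothOn Ω (fun q => g.volDensity q • g.grad u i q) :=
  g.smoothOn_volDensity.smul (g.smoothOn_grad hΩ hu i)

theorem smoothOn_expr (hΩ : IsOpen Ω) (c : ℝ) {u : Cylinder → ℂ} (hu : SmoothOn Ω u) :
    SmoothOn Ω (g.curvatureLaplacianExpr c u) :=
  SmoothOn.add (SmoothOn.neg <| SmoothOn.smul
      (g.smoothOn_volDensity.inv fun _ hp => (g.volDensity_pos hp).ne')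
      (SmoothOn.sum fun _ _ => (g.smoothOn_flux hΩ hu _).pd hΩ _))
    (SmoothOn.smul ((SmoothOn.const c).mul (g.smoothOn_gaussCurvature hΩ)) hu)

theorem expr_eq_zero (c : ℝ) {u : Cylinder → ℂ} {p : Cylinder} (hp : p ∉ tsupport u) :
    g.curvatureLaplacianExpr c u p = 0 := by
  have hgrad : ∀ i, Function.support (fun q => g.volDensity q • g.grad u i q) ⊆ tsupport u := by
    intro i q hq
    by_contra h
    apply hq
    have h0 : ∀ j, pd j u q = 0 := fun j =>
      image_eq_zero_of_notMem_tsupport fun h' => h (tsupport_pd_subset j u h')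
    simp [grad, h0]
  have hflux : ∀ i, pd i (fun q => g.volDensity q • g.grad u i q) p = 0 := fun i =>
    image_eq_zero_of_notMem_tsupport fun h' =>
      hp (closure_minimal (hgrad i) (isClosed_tsupport u) (tsupport_pd_subset i _ h'))
  have hlap : g.laplaceBeltrami u p = 0 := by
    rw [laplaceBeltrami, div, Finset.sum_eq_zero fun i _ => hflux i, smul_zero]
  simp [curvatureLaplacianExpr, hlap, image_eq_zero_of_notMem_tsupport hp]

theorem expr_add (hΩ : IsOpen Ω) (c : ℝ) {u v : Cylinder → ℂ} (hu : SmoothOn Ω u)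
    (hv : SmoothOn Ω v) {p : Cylinder} (hp : p ∈ Ω) :
    g.curvatureLaplacianExpr c (u + v) p =
      g.curvatureLaplacianExpr c u p + g.curvatureLaplacianExpr c v p := by
  have h1 : ∀ i, pd i (fun q => g.volDensity q • g.grad (u + v) i q) p =
      pd i (fun q => g.volDensity q • g.grad u i q) p
        + pd i (fun q => g.volDensity q • g.grad v i q) p := by
    intro i
    rw [← pd_add hΩ (g.smoothOn_flux hΩ hu i) (g.smoothOn_flux hΩ hv i) i hp]
    refine pd_congr i ?_
    filter_upwards [hΩ.mem_nhds hp] with q hq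
    have h2 : ∀ j, pd j (u + v) q = pd j u q + pd j v q := fun j => pd_add hΩ hu hv j hq
    simp only [grad, h2, smul_add, Finset.sum_add_distrib]
  simp only [curvatureLaplacianExpr, laplaceBeltrami, div, h1, Finset.sum_add_distrib, smul_add,
    Pi.add_apply]
  ring

theorem expr_smul (hΩ : IsOpen Ω) (c : ℝ) (a : ℂ) {u : Cylinder → ℂ} (hu : SmoothOn Ω u)
    {p : Cylinder} (hp : p ∈ Ω) :
    g.curvatureLaplacianExpr c (a • u) p = a * g.curvatureLaplacianExpr c u p := by
  have h1 : ∀ i, pd i (fun q => g.volDensity q • g.grad (a • u) i q) p =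
      a * pd i (fun q => g.volDensity q • g.grad u i q) p := by
    intro i
    rw [← pd_const_smul hΩ (g.smoothOn_flux hΩ hu i) a i hp]
    refine pd_congr i ?_
    filter_upwards [hΩ.mem_nhds hp] with q hq
    have h2 : ∀ j, pd j (a • u) q = a * pd j u q := fun j => pd_const_smul hΩ hu a j hq
    simp only [grad, h2, Complex.real_smul, Finset.mul_sum]
    refine Finset.sum_congr rfl fun j _ => ?_
    ring
  have h3 : g.laplaceBeltrami (a • u) p = a * g.laplaceBeltrami u p := by
    rw [laplaceBeltrami, laplaceBeltrami, div, div, Finset.sum_congr rfl fun i _ => h1 i,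
      ← Finset.mul_sum, Complex.real_smul, Complex.real_smul]
    ring
  simp only [curvatureLaplacianExpr, h3, Complex.real_smul, Pi.smul_apply, smul_eq_mul]
  ring

theorem aemeasurable_density (hΩ : IsOpen Ω) :
    AEMeasurable (fun p => ENNReal.ofReal (g.volDensity p)) (volume.restrict Ω) :=
  ((g.smoothOn_volDensity.continuousOn hΩ).aemeasurable hΩ.measurableSet).ennreal_ofReal

theorem vol_lt_top (hΩ : IsOpen Ω) {S : Set Cylinder} (hS : IsCompact S) (hSΩ : S ⊆ Ω) :
    g.vol S < ⊤ := by
  obtain ⟨C, hC⟩ := hS.exists_bound_of_continuousOn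
    ((g.smoothOn_volDensity.continuousOn hΩ).mono hSΩ)
  rw [vol, withDensity_apply _ hS.measurableSet, Measure.restrict_restrict hS.measurableSet,
    inter_eq_left.mpr hSΩ]
  calc ∫⁻ p in S, ENNReal.ofReal (g.volDensity p)
      ≤ ∫⁻ _ in S, ENNReal.ofReal C := by
        refine setLIntegral_mono measurable_const fun p hp => ?_
        exact ENNReal.ofReal_le_ofReal ((le_abs_self _).trans (hC p hp))
    _ < ⊤ := by
        rw [setLIntegral_const]
        exact ENNReal.mul_lt_top ENNReal.ofReal_lt_top hS.measure_lt_top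

theorem memLp_of_compact (hΩ : IsOpen Ω) {S : Set Cylinder} (hS : IsCompact S) (hSΩ : S ⊆ Ω)
    {w : Cylinder → ℂ} (hw : SmoothOn Ω w) (h0 : ∀ p ∉ S, w p = 0) : MemLp w 2 g.vol := by
  have hcont : ContinuousOn w S := (hw.continuousOn hΩ).mono hSΩ
  obtain ⟨C, hC⟩ := hS.exists_bound_of_continuousOn hcont
  have hind : S.indicator w = w := by
    funext p
    by_cases hp : p ∈ S
    · simp [hp]
    · simp [hp, h0 p hp]
  rw [← hind, memLp_indicator_iff_restrict hS.measurableSet]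
  have : IsFiniteMeasure (g.vol.restrict S) :=
    ⟨by rw [Measure.restrict_apply_univ]; exact g.vol_lt_top hΩ hS hSΩ⟩
  exact MemLp.of_bound (hcont.aestronglyMeasurable hS.measurableSet) C
    ((ae_restrict_mem hS.measurableSet).mono fun p hp => hC p hp)

theorem memLp_test (hΩ : IsOpen Ω) (u : testFunctions Ω) : MemLp (u : Cylinder → ℂ) 2 g.vol :=
  g.memLp_of_compact hΩ u.2.2.1 u.2.2.2 (u.2.1.mono (subset_univ _))
    fun _ hp => image_eq_zero_of_notMem_tsupport hp

theorem memLp_expr (hΩ : IsOpen Ω) (c : ℝ) (u : testFunctions Ω) :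
    MemLp (g.curvatureLaplacianExpr c u) 2 g.vol :=
  g.memLp_of_compact hΩ u.2.2.1 u.2.2.2 (g.smoothOn_expr hΩ c (u.2.1.mono (subset_univ _)))
    fun _ hp => g.expr_eq_zero c hp

theorem ae_mem (hΩ : IsOpen Ω) : ∀ᵐ p ∂g.vol, p ∈ Ω :=
  (withDensity_absolutelyContinuous _ _).ae_le (ae_restrict_mem hΩ.measurableSet)

theorem test_eq_zero (hΩ : IsOpen Ω) (u : testFunctions Ω)
    (h : (u : Cylinder → ℂ) =ᵐ[g.vol] 0) : u = 0 := by
  have hcont : Continuous (u : Cylinder → ℂ) :=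
    continuousOn_univ.mp (u.2.1.continuousOn isOpen_univ)
  have hopen : IsOpen (Function.support (u : Cylinder → ℂ)) := hcont.isOpen_support
  have hsub : Function.support (u : Cylinder → ℂ) ⊆ Ω :=
    (subset_tsupport _).trans u.2.2.2
  have h1 : ∀ᵐ p ∂(volume.restrict Ω), ENNReal.ofReal (g.volDensity p) ≠ 0 →
      (u : Cylinder → ℂ) p = 0 :=
    (ae_withDensity_iff' (g.aemeasurable_density hΩ)).mp h
  rw [ae_restrict_iff' hΩ.measurableSet] at h1
  have h2 : volume (Function.support (u : Cylinder → ℂ)) = 0 := by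
    refine measure_mono_null (fun p hp => ?_) (ae_iff.mp h1)
    intro hcon
    have hpos := g.volDensity_pos (hsub hp)
    exact hp (hcon (hsub hp) (by simpa using hpos))
  have h3 := hopen.measure_eq_zero_iff volume |>.mp h2
  exact Subtype.ext (Function.support_eq_empty_iff.mp h3)

/-- The inclusion `C_0^∞(Ω) → L²(Ω, ω)`. -/
def testToLp (hΩ : IsOpen Ω) : testFunctions Ω →ₗ[ℂ] Lp ℂ 2 g.vol where
  toFun u := (g.memLp_test hΩ u).toLp u
  map_add' u v := MemLp.toLp_add (g.memLp_test hΩ u) (g.memLp_test hΩ v)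
  map_smul' a u := MemLp.toLp_const_smul a (g.memLp_test hΩ u)

theorem testToLp_injective (hΩ : IsOpen Ω) : Function.Injective (g.testToLp hΩ) := by
  refine (injective_iff_map_eq_zero _).mpr fun u hu => ?_
  refine g.test_eq_zero hΩ u ?_
  exact (MemLp.coeFn_toLp (g.memLp_test hΩ u)).symm.trans
    ((Lp.eq_zero_iff_ae_eq_zero).mp hu)

/-- The map `u ↦ -Δu + cKu` from `C_0^∞(Ω)` to `L²(Ω, ω)`. -/
def exprToLp (hΩ : IsOpen Ω) (c : ℝ) : testFunctions Ω →ₗ[ℂ] Lp ℂ 2 g.vol where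
  toFun u := (g.memLp_expr hΩ c u).toLp (g.curvatureLaplacianExpr c u)
  map_add' u v := by
    rw [← MemLp.toLp_add, MemLp.toLp_eq_toLp_iff]
    filter_upwards [g.ae_mem hΩ] with p hp
    exact g.expr_add hΩ c (u.2.1.mono (subset_univ _)) (v.2.1.mono (subset_univ _)) hp
  map_smul' a u := by
    rw [RingHom.id_apply, ← MemLp.toLp_const_smul, MemLp.toLp_eq_toLp_iff]
    filter_upwards [g.ae_mem hΩ] with p hp
    exact g.expr_smul hΩ c a (u.2.1.mono (subset_univ _)) hp

/-- The curvature Laplacian `-Δ + cK` as an unbounded operator on `L²(Ω, ω)` with domain (the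
image in `L²(Ω, ω)` of) `C_0^∞(Ω)`. -/
def curvatureLaplacian (hΩ : IsOpen Ω) (c : ℝ) : Lp ℂ 2 g.vol →ₗ.[ℂ] Lp ℂ 2 g.vol where
  domain := LinearMap.range (g.testToLp hΩ)
  toFun := (g.exprToLp hΩ c).comp
    (LinearEquiv.ofInjective (g.testToLp hΩ) (g.testToLp_injective hΩ)).symm.toLinearMap

end RiemannianMetric

/-! ### The local Grushin model -/

/-- The three regions `Ω₊ = {x > 0}`, `Ω₋ = {x < 0}`, `Ω = {x ≠ 0}`. -/
inductive Side
  | plus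
  | minus
  | both

/-- The open subset of `ℝ × S¹` which corresponds to a `Side`. -/
def Side.region : Side → Set Cylinder
  | plus => {p | 0 < p.1}
  | minus => {p | p.1 < 0}
  | both => {p | p.1 ≠ 0}

theorem Side.isOpen_region (s : Side) : IsOpen s.region := by
  cases s
  · exact isOpen_lt continuous_const continuous_fst
  · exact isOpen_lt continuous_fst continuous_const
  · exact isOpen_ne_fun continuous_fst continuous_const

theorem Side.ne_zero {s : Side} {p : Cylinder} (hp : p ∈ s.region) : p.1 ≠ 0 := by
  cases s
  · exact ne_of_gt hp
  · exact ne_of_lt hp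
  · exact hp

/-- The metric `g = diag(1, x⁻² e^{-2φ})`. -/
def metric (φ : Cylinder → ℝ) (hφ : SmoothOn univ φ) (s : Side) : RiemannianMetric s.region where
  coeff p := Matrix.diagonal ![1, (p.1 ^ 2)⁻¹ * Real.exp (-2 * φ p)]
  smooth i j := by
    have hx : SmoothOn s.region (fun p => p.1 ^ 2) :=
      (ContDiff.pow contDiff_fst 2).contDiffOn
    have he : SmoothOn s.region (fun p => Real.exp (-2 * φ p)) :=
      ContDiffOn.exp ((SmoothOn.const (-2)).mul (hφ.mono (subset_univ _)))
    have h := (hx.inv fun p hp => pow_ne_zero 2 (Side.ne_zero hp)).mul he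
    fin_cases i <;> fin_cases j <;> simp [Matrix.diagonal]
    · exact SmoothOn.const 1
    · exact SmoothOn.const 0
    · exact SmoothOn.const 0
    · simpa using h
  posDef p hp := by
    have hx : 0 < (p.1 ^ 2)⁻¹ := by
      have := Side.ne_zero hp
      positivity
    rw [Matrix.posDef_diagonal_iff]
    intro i
    fin_cases i
    · simp
    · simpa using mul_pos hx (Real.exp_pos _)

/-- The operator `-Δ + cK` with domain `C_0^∞(Ω)` on `L²(Ω, ω)`, for the metric
`g = diag(1, x⁻² e^{-2φ})` on one of the three regions. -/
def operator (φ : Cylinder → ℝ) (hφ : SmoothOn univ φ) (s : Side) (c : ℝ) :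
    Lp ℂ 2 (metric φ hφ s).vol →ₗ.[ℂ] Lp ℂ 2 (metric φ hφ s).vol :=
  (metric φ hφ s).curvatureLaplacian s.isOpen_region c

end Grushin

end

/-! Near the circle $x=0$ the operator is a perturbation of an Euler operator in $r=|x|$. The volume
density is $r^{-1}e^{-\varphi}$ and $K=-2/x^2-2\varphi_x/x+\varphi_{xx}-\varphi_x^2$, so the leading
part of $-\Delta+cK$ is $-\partial_r^2+r^{-1}\partial_r-2c\,r^{-2}$. It annihilates $r^{1\pm\nu}$,
where $\nu^2=1-2c$. For $0<c<1/2$ both exponents are positive, so both solutions are square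
integrable against $dr/r$: this is the limit circle case, and each gives an element of $\mathcal
D(A^*)$.

The next term of the operator sends $r^q$ to a multiple of $\varphi_x r^{q-1}$. For $q=1+\nu$ this
is harmless. For $q=1-\nu$ it is of order $r^{-\nu}$, which is not square integrable, so a
correction $b(y)F(r)$ is added, where $F$ solves the inhomogeneous Euler equation with right side
$r^{-\nu}$ (`exists_radialCorrection`) and $b$ cancels $\varphi_x(0,y)$. What remains is
$O(r^{1-\nu})$, because $\varphi_x$ is Lipschitz in $x$. Both functions are cut off at radius
$2\delta$ and extended by zero.

Independence modulo $\mathcal D(\overline A)$ is detected by the bilinear boundary pairing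
$[h,k]=\int(Eh\,k-h\,Ek)\,d\omega$, where $E$ is the differential expression. It vanishes when one
entry is a test function, and `integral_closure` with `integral_mul_closure` extends this to
combinations of $h_+,h_-$ lying in $\mathcal D(\overline A)$. Green's formula with cutoffs tending
to 1 off the circle (`green_cutoff`) expresses $[h_+,h_-]$ as the limit of averages of the weighted
Wronskian $e^{-\varphi}(2\nu+br)$ over shrinking collars. This is bounded below by a positive
constant for small $r$ (`pairing_ne_zero`), and antisymmetry of the pairing then forces both
coefficients of such a combination to vanish (`linearIndependent_mkQ`). Either function lies in the
domain of $(\overline A)^*$ but not in that of $\overline A$, so $\overline A$ is not self-adjoint.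
-/

noncomputable section

namespace Grushin

/-! ### Calculus and the divergence theorem on the cylinder -/

section Calculus

variable {E : Type*} [NormedAddCommGroup E] [NormedSpace ℝ E] {Ω : Set Cylinder}

theorem SmoothOn.congr {f h : Cylinder → E} (hf : SmoothOn Ω f) (e : ∀ p ∈ Ω, h p = f p) :
    SmoothOn Ω h := ContDiffOn.congr hf fun _ hq => e _ hq

theorem SmoothOn.union {Ω' : Set Cylinder} (hΩ : IsOpen Ω) (hΩ' : IsOpen Ω') {f : Cylinder → E}
    (hf : SmoothOn Ω f) (hf' : SmoothOn Ω' f) : SmoothOn (Ω ∪ Ω') f := by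
  have := ContDiffOn.union_of_isOpen hf hf' (hΩ.preimage continuous_cover)
    (hΩ'.preimage continuous_cover)
  exact this

theorem SmoothOn.cmul {f h : Cylinder → ℂ} (hf : SmoothOn Ω f) (hh : SmoothOn Ω h) :
    SmoothOn Ω (fun p => f p * h p) := ContDiffOn.mul hf hh

theorem SmoothOn.ofReal {f : Cylinder → ℝ} (hf : SmoothOn Ω f) :
    SmoothOn Ω (fun p => (f p : ℂ)) := Complex.ofRealCLM.contDiff.comp_contDiffOn hf

theorem SmoothOn.comp_fst {a : ℝ → E} {U : Set ℝ} (ha : ContDiffOn ℝ ∞ a U)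
    (h : ∀ p ∈ Ω, p.1 ∈ U) : SmoothOn Ω (fun p => a p.1) :=
  ha.comp (g := a) (f := Prod.fst) contDiff_fst.contDiffOn fun _ hq => h _ hq

/-- A smooth function on an open set which vanishes off a closed subset is globally smooth. -/
theorem SmoothOn.of_eq_zero (hΩ : IsOpen Ω) {S : Set Cylinder} (hS : IsClosed S) (hSΩ : S ⊆ Ω)
    {f : Cylinder → E} (hf : SmoothOn Ω f) (h0 : ∀ p ∉ S, f p = 0) : SmoothOn univ f := by
  have h1 : SmoothOn Sᶜ f := (SmoothOn.const (0 : E)).congr fun p hp => h0 p hp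
  refine (hf.union hΩ hS.isOpen_compl h1).mono fun p _ => ?_
  by_cases hp : p ∈ S
  · exact Or.inl (hSΩ hp)
  · exact Or.inr hp

theorem SmoothOn.hasDerivAt_zero (hΩ : IsOpen Ω) {f : Cylinder → E} (hf : SmoothOn Ω f)
    {p : Cylinder} (hp : p ∈ Ω) :
    HasDerivAt (fun t : ℝ => f (p.1 + t, p.2)) (Grushin.pd 0 f p) 0 := by
  obtain ⟨q, rfl⟩ := cover_surjective p
  rw [pd_cover 0 f q (hf.differentiableAt hΩ hp)]
  exact pd_zero_cover f q (hf.differentiableAt hΩ hp)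

theorem SmoothOn.hasDerivAt_one (hΩ : IsOpen Ω) {f : Cylinder → E} (hf : SmoothOn Ω f)
    {p : Cylinder} (hp : p ∈ Ω) :
    HasDerivAt (fun t : ℝ => f (p.1, p.2 + (t : AddCircle (2 * Real.pi))))
      (Grushin.pd 1 f p) 0 := by
  obtain ⟨q, rfl⟩ := cover_surjective p
  rw [pd_cover 1 f q (hf.differentiableAt hΩ hp)]
  exact pd_one_cover f q (hf.differentiableAt hΩ hp)

/-- The derivative of a smooth function along the horizontal line. -/
theorem SmoothOn.hasDerivAt_fst (hΩ : IsOpen Ω) {f : Cylinder → E} (hf : SmoothOn Ω f)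
    {p : Cylinder} (hp : p ∈ Ω) :
    HasDerivAt (fun x : ℝ => f (x, p.2)) (Grushin.pd 0 f p) p.1 := by
  have h := hf.hasDerivAt_zero hΩ hp
  have h2 : HasDerivAt (fun x : ℝ => x - p.1) 1 p.1 := (hasDerivAt_id _).sub_const _
  have h3 := HasDerivAt.scomp (g₁ := fun t : ℝ => f (p.1 + t, p.2)) (h := fun x : ℝ => x - p.1)
    p.1 (by simpa using h) h2
  simpa [Function.comp_def] using h3

theorem pd_zero_eq {f : Cylinder → E} {p : Cylinder} {f' : E}
    (h : HasDerivAt (fun x : ℝ => f (x, p.2)) f' p.1) : Grushin.pd 0 f p = f' := by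
  have h2 : HasDerivAt (fun t : ℝ => p.1 + t) 1 0 := (hasDerivAt_id _).const_add _
  have h3 := HasDerivAt.scomp (g₁ := fun x : ℝ => f (x, p.2)) (h := fun t : ℝ => p.1 + t)
    0 (by simpa using h) h2
  change deriv (fun t : ℝ => f (p.1 + t, p.2)) 0 = f'
  simpa [Function.comp_def] using h3.deriv

/-- The Leibniz rule for a continuous bilinear map. -/
theorem pd_bilin {F G : Type*} [NormedAddCommGroup F] [NormedSpace ℝ F]
    [NormedAddCommGroup G] [NormedSpace ℝ G] (B : E →L[ℝ] F →L[ℝ] G) (hΩ : IsOpen Ω)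
    {f : Cylinder → E} {h : Cylinder → F} (hf : SmoothOn Ω f) (hh : SmoothOn Ω h)
    (i : Fin 2) {p : Cylinder} (hp : p ∈ Ω) :
    Grushin.pd i (fun q => B (f q) (h q)) p
      = B (f p) (Grushin.pd i h p) + B (Grushin.pd i f p) (h p) := by
  fin_cases i
  · have := (B.hasFDerivAt_of_bilinear (hf.hasDerivAt_zero hΩ hp).hasFDerivAt
      (hh.hasDerivAt_zero hΩ hp).hasFDerivAt).hasDerivAt.deriv
    simpa [Grushin.pd] using this
  · have := (B.hasFDerivAt_of_bilinear (hf.hasDerivAt_one hΩ hp).hasFDerivAt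
      (hh.hasDerivAt_one hΩ hp).hasFDerivAt).hasDerivAt.deriv
    simpa [Grushin.pd] using this

theorem pd_smul (hΩ : IsOpen Ω) {a : Cylinder → ℝ} {f : Cylinder → E} (ha : SmoothOn Ω a)
    (hf : SmoothOn Ω f) (i : Fin 2) {p : Cylinder} (hp : p ∈ Ω) :
    Grushin.pd i (fun q => a q • f q) p
      = a p • Grushin.pd i f p + Grushin.pd i a p • f p :=
  pd_bilin (ContinuousLinearMap.lsmul ℝ ℝ) hΩ ha hf i hp

theorem pd_mul (hΩ : IsOpen Ω) {a f : Cylinder → ℝ} (ha : SmoothOn Ω a)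
    (hf : SmoothOn Ω f) (i : Fin 2) {p : Cylinder} (hp : p ∈ Ω) :
    Grushin.pd i (fun q => a q * f q) p
      = a p * Grushin.pd i f p + Grushin.pd i a p * f p := pd_smul hΩ ha hf i hp

theorem pd_cmul (hΩ : IsOpen Ω) {a f : Cylinder → ℂ} (ha : SmoothOn Ω a)
    (hf : SmoothOn Ω f) (i : Fin 2) {p : Cylinder} (hp : p ∈ Ω) :
    Grushin.pd i (fun q => a q * f q) p
      = a p * Grushin.pd i f p + Grushin.pd i a p * f p :=
  pd_bilin (ContinuousLinearMap.mul ℝ ℂ) hΩ ha hf i hp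

theorem pd_comp_clm {F : Type*} [NormedAddCommGroup F] [NormedSpace ℝ F] (B : E →L[ℝ] F)
    (hΩ : IsOpen Ω) {f : Cylinder → E} (hf : SmoothOn Ω f)
    (i : Fin 2) {p : Cylinder} (hp : p ∈ Ω) :
    Grushin.pd i (fun q => B (f q)) p = B (Grushin.pd i f p) := by
  fin_cases i
  · exact (B.hasFDerivAt.comp_hasDerivAt (0 : ℝ) (hf.hasDerivAt_zero hΩ hp)).deriv
  · exact (B.hasFDerivAt.comp_hasDerivAt (0 : ℝ) (hf.hasDerivAt_one hΩ hp)).deriv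

theorem pd_sub (hΩ : IsOpen Ω) {f h : Cylinder → E} (hf : SmoothOn Ω f) (hh : SmoothOn Ω h)
    (i : Fin 2) {p : Cylinder} (hp : p ∈ Ω) :
    Grushin.pd i (fun q => f q - h q) p = Grushin.pd i f p - Grushin.pd i h p := by
  fin_cases i
  · exact ((hf.hasDerivAt_zero hΩ hp).sub (hh.hasDerivAt_zero hΩ hp)).deriv
  · exact ((hf.hasDerivAt_one hΩ hp).sub (hh.hasDerivAt_one hΩ hp)).deriv

theorem SmoothOn.continuous {f : Cylinder → E} (hf : SmoothOn univ f) : Continuous f :=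
  continuousOn_univ.mp (hf.continuousOn isOpen_univ)

/-- The divergence theorem for compactly supported functions on the cylinder. -/
theorem integral_pd_eq_zero [CompleteSpace E] (i : Fin 2) {f : Cylinder → E}
    (hf : SmoothOn univ f) (hc : HasCompactSupport f) : ∫ p, Grushin.pd i f p = 0 := by
  have hpc : Continuous (Grushin.pd i f) := (hf.pd isOpen_univ i).continuous
  have hps : HasCompactSupport (Grushin.pd i f) :=
    hc.of_isClosed_subset (isClosed_tsupport _) (tsupport_pd_subset i f)
  have hint : Integrable (Grushin.pd i f) := hpc.integrable_of_hasCompactSupport hps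
  have hint0 : Integrable f := hf.continuous.integrable_of_hasCompactSupport hc
  fin_cases i
  · rw [Measure.volume_eq_prod] at hint hint0 ⊢
    rw [integral_prod_symm _ hint]
    refine integral_eq_zero_of_ae ?_
    filter_upwards [hint.prod_left_ae, hint0.prod_left_ae] with y hy hy0
    exact integral_eq_zero_of_hasDerivAt_of_integrable
      (fun x => hf.hasDerivAt_fst isOpen_univ (mem_univ (x, y))) hy hy0
  · rw [Measure.volume_eq_prod] at hint ⊢
    rw [integral_prod _ hint]
    refine integral_eq_zero_of_ae (Eventually.of_forall fun x => ?_)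
    -- In the angular direction the integral runs over one period of the lift, whose two endpoints
    -- are the same point of the circle.
    have hd : ∀ y : ℝ, HasDerivAt (fun t : ℝ => f (x, (t : AddCircle (2 * Real.pi))))
        (Grushin.pd 1 f (x, (y : AddCircle (2 * Real.pi)))) y := by
      intro y
      have h := hf.hasDerivAt_one isOpen_univ (mem_univ (x, (y : AddCircle (2 * Real.pi))))
      have h2 : HasDerivAt (fun t : ℝ => t - y) 1 y := (hasDerivAt_id _).sub_const _
      have h3 := HasDerivAt.scomp
        (g₁ := fun t : ℝ => f (x, (y : AddCircle (2 * Real.pi)) + (t : AddCircle (2 * Real.pi))))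
        (h := fun t : ℝ => t - y) y (by simpa using h) h2
      simpa [Function.comp_def] using h3
    have h1 := AddCircle.intervalIntegral_preimage (2 * Real.pi) 0
      (fun y => Grushin.pd 1 f (x, y))
    have h2 := intervalIntegral.integral_eq_sub_of_hasDerivAt (a := 0) (b := 0 + 2 * Real.pi)
      (fun y _ => hd y) (Continuous.intervalIntegrable
        (hpc.comp (continuous_const.prodMk (AddCircle.continuous_mk' _))) _ _)
    have h3 : ((0 + 2 * Real.pi : ℝ) : AddCircle (2 * Real.pi)) = (0 : ℝ) := by
      simp
    rw [h3, sub_self] at h2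
    exact h1.symm.trans h2

end Calculus


/-! ### Green's formula for $-\Delta+cK$ -/

namespace RiemannianMetric

variable {Ω : Set Cylinder} (g : RiemannianMetric Ω)

theorem inv_symm {p : Cylinder} (hp : p ∈ Ω) (i j : Fin 2) : g.inv i j p = g.inv j i p := by
  have h : (g.coeff p)⁻¹.IsHermitian := (g.posDef p hp).isHermitian.inv
  simpa [inv] using h.apply j i

theorem integral_vol (hΩ : IsOpen Ω) (w : Cylinder → ℂ) :
    ∫ p, w p ∂g.vol = ∫ p in Ω, g.volDensity p • w p := by
  rw [vol, integral_withDensity_eq_integral_toReal_smul₀ (g.aemeasurable_density hΩ)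
    (Eventually.of_forall fun _ => ENNReal.ofReal_lt_top)]
  refine setIntegral_congr_fun hΩ.measurableSet fun p hp => ?_
  simp only [ENNReal.toReal_ofReal (g.volDensity_pos hp).le]

/-- The flux `√(det g) (k grad h - h grad k)`. -/
def flux (h k : Cylinder → ℂ) (i : Fin 2) (p : Cylinder) : ℂ :=
  g.volDensity p • (g.grad h i p * k p - h p * g.grad k i p)

theorem smoothOn_greenFlux (hΩ : IsOpen Ω) {h k : Cylinder → ℂ} (hh : SmoothOn Ω h)
    (hk : SmoothOn Ω k) (i : Fin 2) : SmoothOn Ω (g.flux h k i) :=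
  g.smoothOn_volDensity.smul (((g.smoothOn_grad hΩ hh i).cmul hk).sub
    (hh.cmul (g.smoothOn_grad hΩ hk i)))

theorem flux_eq_zero (h : Cylinder → ℂ) {k : Cylinder → ℂ} (i : Fin 2) {p : Cylinder}
    (hp : p ∉ tsupport k) : g.flux h k i p = 0 := by
  have h0 : ∀ j, pd j k p = 0 := fun j =>
    image_eq_zero_of_notMem_tsupport fun h' => hp (tsupport_pd_subset j k h')
  simp [flux, grad, h0, image_eq_zero_of_notMem_tsupport hp]

/-- The product rule gives the two divergence terms and the cross terms $\rho
g^{ij}(\partial_jh\,\partial_ik-\partial_jk\,\partial_ih)$. The cross terms cancel in the sum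
because $g^{ij}$ is symmetric, and the potential $cK$ cancels because it has order zero. -/
theorem sum_pd_flux (hΩ : IsOpen Ω) (c : ℝ) {h k : Cylinder → ℂ} (hh : SmoothOn Ω h)
    (hk : SmoothOn Ω k) {p : Cylinder} (hp : p ∈ Ω) :
    ∑ i, pd i (g.flux h k i) p = -(g.volDensity p • (g.curvatureLaplacianExpr c h p * k p
      - h p * g.curvatureLaplacianExpr c k p)) := by
  have h1 : ∀ i, pd i (g.flux h k i) p =
      (pd i (fun q => g.volDensity q • g.grad h i q) p * k p
        - h p * pd i (fun q => g.volDensity q • g.grad k i q) p)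
      + (g.volDensity p • g.grad h i p * pd i k p
        - g.volDensity p • g.grad k i p * pd i h p) := by
    intro i
    have e : g.flux h k i = fun q => (g.volDensity q • g.grad h i q) * k q
        - h q * (g.volDensity q • g.grad k i q) := by
      funext q
      simp only [flux, Complex.real_smul]
      ring
    rw [e, pd_sub hΩ ((g.smoothOn_flux hΩ hh i).cmul hk) (hh.cmul (g.smoothOn_flux hΩ hk i)) i hp,
      pd_cmul hΩ (g.smoothOn_flux hΩ hh i) hk i hp, pd_cmul hΩ hh (g.smoothOn_flux hΩ hk i) i hp]
    ring
  have h2 : (g.volDensity p : ℂ) ≠ 0 := by exact_mod_cast (g.volDensity_pos hp).ne'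
  have h3 := g.inv_symm hp 0 1
  simp only [h1, curvatureLaplacianExpr, laplaceBeltrami, div, Fin.sum_univ_two, grad,
    Complex.real_smul, Complex.ofReal_inv, Complex.ofReal_mul]
  field_simp
  rw [h3]
  ring

/-- Green's formula with a cutoff function `η`. -/
theorem green_cutoff (hΩ : IsOpen Ω) (c : ℝ) {h k : Cylinder → ℂ} (hh : SmoothOn Ω h)
    (hk : SmoothOn Ω k) {η : Cylinder → ℝ} (hη : SmoothOn Ω η) {S : Set Cylinder}
    (hS : IsCompact S) (hSΩ : S ⊆ Ω) (h0 : ∀ p ∉ S, η p = 0 ∨ p ∉ tsupport k) :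
    ∫ p, η p • (g.curvatureLaplacianExpr c h p * k p - h p * g.curvatureLaplacianExpr c k p) ∂g.vol
      = ∫ p in Ω, ∑ i, pd i η p • g.flux h k i p := by
  have hV := g.smoothOn_greenFlux hΩ hh hk
  have hz : ∀ i, ∀ p ∉ S, η p • g.flux h k i p = 0 := fun i p hp => by
    rcases h0 p hp with h1 | h1
    · rw [h1, zero_smul]
    · rw [g.flux_eq_zero h i h1, smul_zero]
  have hsm : ∀ i, SmoothOn univ (fun p => η p • g.flux h k i p) := fun i =>
    SmoothOn.of_eq_zero hΩ hS.isClosed hSΩ (hη.smul (hV i)) (hz i)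
  have hcs : ∀ i, HasCompactSupport (fun p => η p • g.flux h k i p) := fun i =>
    HasCompactSupport.intro hS (hz i)
  have hzero : ∀ i, ∫ p in Ω, pd i (fun p => η p • g.flux h k i p) p = 0 := fun i => by
    rw [setIntegral_eq_integral_of_forall_compl_eq_zero, integral_pd_eq_zero i (hsm i) (hcs i)]
    intro p hp
    refine image_eq_zero_of_notMem_tsupport fun h' => hp (hSΩ ?_)
    exact closure_minimal (Function.support_subset_iff'.mpr (hz i)) hS.isClosed
      (tsupport_pd_subset i _ h')
  have hi : ∀ i, Integrable (pd i (fun p => η p • g.flux h k i p)) (volume.restrict Ω) := fun i =>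
    (((hsm i).pd isOpen_univ i).continuous.integrable_of_hasCompactSupport
      ((hcs i).of_isClosed_subset (isClosed_tsupport _) (tsupport_pd_subset i _))).restrict
  have hexpr : ∀ p ∉ S, η p • (g.volDensity p •
      (g.curvatureLaplacianExpr c h p * k p - h p * g.curvatureLaplacianExpr c k p)) = 0 := by
    intro p hp
    rcases h0 p hp with h1 | h1
    · rw [h1, zero_smul]
    · rw [g.expr_eq_zero c h1, image_eq_zero_of_notMem_tsupport h1]
      simp
  have hi2 : Integrable (fun p => η p • (g.volDensity p • (g.curvatureLaplacianExpr c h p * k p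
      - h p * g.curvatureLaplacianExpr c k p))) (volume.restrict Ω) := by
    have : SmoothOn univ (fun p => η p • (g.volDensity p • (g.curvatureLaplacianExpr c h p * k p
      - h p * g.curvatureLaplacianExpr c k p))) :=
      SmoothOn.of_eq_zero hΩ hS.isClosed hSΩ (hη.smul (g.smoothOn_volDensity.smul
        (((g.smoothOn_expr hΩ c hh).cmul hk).sub (hh.cmul (g.smoothOn_expr hΩ c hk))))) hexpr
    exact (this.continuous.integrable_of_hasCompactSupport
      (HasCompactSupport.intro hS hexpr)).restrict
  have key : ∫ p in Ω, ∑ i, pd i (fun p => η p • g.flux h k i p) p = 0 := by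
    rw [integral_finsetSum _ fun i _ => hi i]
    exact Finset.sum_eq_zero fun i _ => hzero i
  -- With $V$ the flux, $\partial_i\eta\,V_i=\partial_i(\eta V_i)-\eta\,\partial_iV_i$. The first
  -- term integrates to zero and the second is given by `sum_pd_flux`.
  have hpt : ∀ p ∈ Ω, ∑ i, pd i η p • g.flux h k i p =
      ∑ i, pd i (fun p => η p • g.flux h k i p) p + η p • (g.volDensity p •
        (g.curvatureLaplacianExpr c h p * k p - h p * g.curvatureLaplacianExpr c k p)) := by
    intro p hp
    have h1 := g.sum_pd_flux hΩ c hh hk hp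
    rw [Finset.sum_congr rfl fun i _ => pd_smul hΩ hη (hV i) i hp, Finset.sum_add_distrib,
      ← Finset.smul_sum, h1, smul_neg]
    abel
  rw [setIntegral_congr_fun hΩ.measurableSet hpt,
    integral_add (integrable_finsetSum _ fun i _ => hi i) hi2, key, zero_add, g.integral_vol hΩ]
  refine integral_congr_ae (Eventually.of_forall fun p => ?_)
  simp only [smul_comm (g.volDensity p) (η p)]

theorem integrable_of_compact (hΩ : IsOpen Ω) {S : Set Cylinder} (hS : IsCompact S) (hSΩ : S ⊆ Ω)
    {w : Cylinder → ℂ} (hw : SmoothOn Ω w) (h0 : ∀ p ∉ S, w p = 0) : Integrable w g.vol := by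
  have hcont : ContinuousOn w S := (hw.continuousOn hΩ).mono hSΩ
  obtain ⟨C, hC⟩ := hS.exists_bound_of_continuousOn hcont
  have hind : S.indicator w = w := by
    funext p
    by_cases hp : p ∈ S
    · simp [hp]
    · simp [hp, h0 p hp]
  rw [← hind, integrable_indicator_iff hS.measurableSet]
  exact IntegrableOn.of_bound (g.vol_lt_top hΩ hS hSΩ) (hcont.aestronglyMeasurable hS.measurableSet)
    C ((ae_restrict_mem hS.measurableSet).mono fun p hp => hC p hp)

/-- The formal symmetry of `-Δ + cK`. -/
theorem green_test (hΩ : IsOpen Ω) (c : ℝ) {h : Cylinder → ℂ} (hh : SmoothOn Ω h)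
    (u : testFunctions Ω) :
    ∫ p, g.curvatureLaplacianExpr c h p * (u : Cylinder → ℂ) p ∂g.vol =
      ∫ p, h p * g.curvatureLaplacianExpr c u p ∂g.vol := by
  have hu : SmoothOn Ω (u : Cylinder → ℂ) := u.2.1.mono (subset_univ _)
  have h2 : ∀ i : Fin 2, ∀ p, pd i (fun _ : Cylinder => (1 : ℝ)) p = 0 := by
    intro i p
    fin_cases i <;> simp [pd]
  -- With $\eta=1$ the compact set is the support of the test function, and no boundary term is
  -- left.
  have h3 := g.green_cutoff hΩ c hh hu (SmoothOn.const (1 : ℝ)) u.2.2.1 u.2.2.2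
    fun p hp => Or.inr hp
  simp only [h2, zero_smul, Finset.sum_const_zero, integral_zero, one_smul] at h3
  rw [integral_sub] at h3
  · exact sub_eq_zero.mp h3
  · exact g.integrable_of_compact hΩ u.2.2.1 u.2.2.2 ((g.smoothOn_expr hΩ c hh).cmul hu)
      fun p hp => by rw [image_eq_zero_of_notMem_tsupport hp, mul_zero]
  · exact g.integrable_of_compact hΩ u.2.2.1 u.2.2.2 (hh.cmul (g.smoothOn_expr hΩ c hu))
      fun p hp => by rw [g.expr_eq_zero c hp, mul_zero]

end RiemannianMetric

end Grushin

/-! ### Pairings with the closure and the adjoint -/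

/-- A pairing identity on the domain of an operator persists on the domain of its closure. -/
theorem LinearPMap.inner_closure_eq {𝕜 E F : Type*} [RCLike 𝕜] [NormedAddCommGroup E]
    [InnerProductSpace 𝕜 E] [NormedAddCommGroup F] [InnerProductSpace 𝕜 F] {T : E →ₗ.[𝕜] F}
    {y : F} {y' : E} (h : ∀ x : T.domain, inner 𝕜 y (T x) = inner 𝕜 y' (x : E))
    (x : T.closure.domain) : inner 𝕜 y (T.closure x) = inner 𝕜 y' (x : E) := by
  by_cases hT : T.IsClosable
  -- The identity says that the graph of `T` lies in the zero set of a continuous function, and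
  -- hence so does its closure.
  · have h1 : ((x : E), T.closure x) ∈ T.graph.topologicalClosure := by
      rw [hT.graph_closure_eq_closure_graph]
      exact T.closure.mem_graph x
    have hclosed : _root_.IsClosed {q : E × F | inner 𝕜 y q.2 = inner 𝕜 y' q.1} :=
      isClosed_eq (continuous_const.inner continuous_snd) (continuous_const.inner continuous_fst)
    refine closure_minimal (fun q hq => ?_) hclosed h1
    obtain ⟨z, hz⟩ := T.mem_graph_iff.mp hq
    rw [mem_ofPred_eq, ← hz.1, ← hz.2]
    exact h z
  -- For an operator that is not closable, `closure` is by convention the operator itself, so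
  -- closability never has to be proved.
  · revert x
    rw [LinearPMap.closure_def' hT]
    exact h

namespace Grushin

/-- Conjugating the first entry undoes the conjugation in the inner product. All pairings thus
become bilinear integrals, the form in which Green's formula is stated. -/
theorem inner_toLp_star {μ : Measure Cylinder} {h : Cylinder → ℂ} (hh : MemLp (star h) 2 μ)
    (z : Lp ℂ 2 μ) : inner ℂ (hh.toLp (star h)) z = ∫ p, h p * z p ∂μ := by
  rw [L2.inner_def]
  refine integral_congr_ae ?_
  filter_upwards [hh.coeFn_toLp] with p hp
  rw [hp]
  simp [mul_comm]

namespace RiemannianMetric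

variable {Ω : Set Cylinder} (g : RiemannianMetric Ω)

theorem exists_test (hΩ : IsOpen Ω) (c : ℝ) (x : (g.curvatureLaplacian hΩ c).domain) :
    ∃ u : testFunctions Ω, (x : Lp ℂ 2 g.vol) = g.testToLp hΩ u ∧
      g.curvatureLaplacian hΩ c x = g.exprToLp hΩ c u := by
  let e := LinearEquiv.ofInjective (g.testToLp hΩ) (g.testToLp_injective hΩ)
  refine ⟨e.symm x, ?_, rfl⟩
  exact congrArg Subtype.val (e.apply_symm_apply x).symm

theorem inner_curvatureLaplacian (hΩ : IsOpen Ω) (c : ℝ) {h : Cylinder → ℂ}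
    (hh : SmoothOn Ω h) (h1 : MemLp (star h) 2 g.vol)
    (h2 : MemLp (star (g.curvatureLaplacianExpr c h)) 2 g.vol)
    (x : (g.curvatureLaplacian hΩ c).domain) :
    inner ℂ (h1.toLp (star h)) (g.curvatureLaplacian hΩ c x)
      = inner ℂ (h2.toLp (star (g.curvatureLaplacianExpr c h))) (x : Lp ℂ 2 g.vol) := by
  obtain ⟨u, hu, hu'⟩ := g.exists_test hΩ c x
  rw [hu, hu', inner_toLp_star, inner_toLp_star]
  have e1 : ∫ p, h p * (g.exprToLp hΩ c u) p ∂g.vol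
      = ∫ p, h p * g.curvatureLaplacianExpr c u p ∂g.vol := by
    refine integral_congr_ae ?_
    filter_upwards [(g.memLp_expr hΩ c u).coeFn_toLp] with p hp
    exact congrArg (h p * ·) hp
  have e2 : ∫ p, g.curvatureLaplacianExpr c h p * (g.testToLp hΩ u) p ∂g.vol
      = ∫ p, g.curvatureLaplacianExpr c h p * (u : Cylinder → ℂ) p ∂g.vol := by
    refine integral_congr_ae ?_
    filter_upwards [(g.memLp_test hΩ u).coeFn_toLp] with p hp
    exact congrArg (g.curvatureLaplacianExpr c h p * ·) hp
  rw [e1, e2, g.green_test hΩ c hh u]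

/-- The formal symmetry against test functions is a pairing identity on the domain of $A$, so it
passes to $\overline A$. The function `h` need not have compact support. -/
theorem integral_closure (hΩ : IsOpen Ω) (c : ℝ) {h : Cylinder → ℂ}
    (hh : SmoothOn Ω h) (h1 : MemLp h 2 g.vol)
    (h2 : MemLp (g.curvatureLaplacianExpr c h) 2 g.vol)
    (x : (g.curvatureLaplacian hΩ c).closure.domain) :
    ∫ p, h p * (g.curvatureLaplacian hΩ c).closure x p ∂g.vol
      = ∫ p, g.curvatureLaplacianExpr c h p * (x : Lp ℂ 2 g.vol) p ∂g.vol := by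
  have := LinearPMap.inner_closure_eq (g.inner_curvatureLaplacian hΩ c hh h1.star h2.star) x
  rwa [inner_toLp_star, inner_toLp_star] at this

/-- If a smooth function `f` is in the domain of the closure, then the closure acts on it, weakly
against functions which are approximated by test functions, as `-Δ + cK`. -/
theorem integral_mul_closure (hΩ : IsOpen Ω) (c : ℝ) {f k : Cylinder → ℂ} (hf : SmoothOn Ω f)
    (hf1 : MemLp f 2 g.vol) (hf2 : MemLp (g.curvatureLaplacianExpr c f) 2 g.vol)
    (hk : MemLp k 2 g.vol) {η : ℕ → Cylinder → ℝ} (hη : ∀ n, Measurable (η n))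
    (hη1 : ∀ n p, |η n p| ≤ 1)
    (hlim : ∀ p ∈ Ω, Tendsto (fun n => η n p) atTop (𝓝 1))
    (htest : ∀ n, (fun p => η n p • k p) ∈ testFunctions Ω)
    (x : (g.curvatureLaplacian hΩ c).closure.domain) (hx : (x : Lp ℂ 2 g.vol) = hf1.toLp f) :
    ∫ p, k p * (g.curvatureLaplacian hΩ c).closure x p ∂g.vol
      = ∫ p, k p * g.curvatureLaplacianExpr c f p ∂g.vol := by
  have hlimit : ∀ z : Cylinder → ℂ, MemLp z 2 g.vol →
      Tendsto (fun n => ∫ p, (η n p • k p) * z p ∂g.vol) atTop (𝓝 (∫ p, k p * z p ∂g.vol)) := by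
    intro z hz
    have hi : Integrable (fun p => k p * z p) g.vol := hk.integrable_mul hz
    refine tendsto_integral_of_dominated_convergence (fun p => ‖k p * z p‖) (fun n => ?_) hi.norm
      (fun n => Eventually.of_forall fun p => ?_) ?_
    · exact ((hη n).aestronglyMeasurable.smul hk.1).mul hz.1
    · rw [smul_mul_assoc, norm_smul]
      exact mul_le_of_le_one_left (norm_nonneg _) (hη1 n p)
    · filter_upwards [g.ae_mem hΩ] with p hp
      have := (hlim p hp).smul_const (k p * z p)
      simpa [mul_assoc] using this
  -- For the test function $u=\eta_nk$, the closure is moved from $x=f$ onto $u$, and Green's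
  -- formula moves the expression back onto $f$. Only this weak identity is passed to the limit, so
  -- no bound on the derivatives of $\eta_n$ is needed.
  have heq : ∀ n, ∫ p, (η n p • k p) * (g.curvatureLaplacian hΩ c).closure x p ∂g.vol
      = ∫ p, (η n p • k p) * g.curvatureLaplacianExpr c f p ∂g.vol := by
    intro n
    let u : testFunctions Ω := ⟨_, htest n⟩
    have h1 := g.integral_closure hΩ c (h := u) (u.2.1.mono (subset_univ _)) (g.memLp_test hΩ u)
      (g.memLp_expr hΩ c u) x
    have h2 := g.green_test hΩ c hf u
    have h3 : ∫ p, g.curvatureLaplacianExpr c u p * (x : Lp ℂ 2 g.vol) p ∂g.vol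
        = ∫ p, f p * g.curvatureLaplacianExpr c u p ∂g.vol := by
      refine integral_congr_ae ?_
      rw [hx]
      filter_upwards [hf1.coeFn_toLp] with p hp
      rw [hp, mul_comm]
    refine h1.trans (h3.trans (h2.symm.trans ?_))
    exact integral_congr_ae (Eventually.of_forall fun p => mul_comm _ _)
  have hz := Lp.memLp ((g.curvatureLaplacian hΩ c).closure x)
  refine tendsto_nhds_unique (hlimit _ hz) ?_
  simp only [heq]
  exact hlimit _ hf2

/-- Functions with non-vanishing boundary pairing are independent modulo the domain of the
closure. -/
theorem linearIndependent_mkQ (hΩ : IsOpen Ω) (c : ℝ) {h : Fin 2 → Cylinder → ℂ}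
    (hh : ∀ i, SmoothOn Ω (h i)) (hL2 : ∀ i, MemLp (h i) 2 g.vol)
    (hE : ∀ i, MemLp (g.curvatureLaplacianExpr c (h i)) 2 g.vol)
    {η : ℕ → Cylinder → ℝ} (hη : ∀ n, Measurable (η n))
    (hη1 : ∀ n p, |η n p| ≤ 1)
    (hlim : ∀ p ∈ Ω, Tendsto (fun n => η n p) atTop (𝓝 1))
    (htest : ∀ i n, (fun p => η n p • h i p) ∈ testFunctions Ω)
    (hI : ∫ p, (g.curvatureLaplacianExpr c (h 0) p * h 1 p
      - h 0 p * g.curvatureLaplacianExpr c (h 1) p) ∂g.vol ≠ 0) :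
    LinearIndependent ℂ (fun i =>
      (g.curvatureLaplacian hΩ c).closure.domain.mkQ ((hL2 i).toLp (h i))) := by
  rw [Fintype.linearIndependent_iff]
  intro a ha
  rw [Fin.sum_univ_two, ← map_smul, ← map_smul, ← map_add, Submodule.mkQ_apply,
    Submodule.Quotient.mk_eq_zero, ← MemLp.toLp_const_smul, ← MemLp.toLp_const_smul,
    ← MemLp.toLp_add] at ha
  have hs : ∀ i, SmoothOn Ω (a i • h i) := fun i => ContDiffOn.const_smul (a i) (hh i)
  have hf : SmoothOn Ω (a 0 • h 0 + a 1 • h 1) :=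
    SmoothOn.add (hs 0) (hs 1)
  have hexpr : ∀ p ∈ Ω, g.curvatureLaplacianExpr c (a 0 • h 0 + a 1 • h 1) p =
      a 0 * g.curvatureLaplacianExpr c (h 0) p + a 1 * g.curvatureLaplacianExpr c (h 1) p := by
    intro p hp
    rw [g.expr_add hΩ c (hs 0) (hs 1) hp, g.expr_smul hΩ c _ (hh 0) hp, g.expr_smul hΩ c _ (hh 1) hp]
  have hf2 : MemLp (g.curvatureLaplacianExpr c (a 0 • h 0 + a 1 • h 1)) 2 g.vol := by
    refine (memLp_congr_ae ?_).mpr (((hE 0).const_mul (a 0)).add ((hE 1).const_mul (a 1)))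
    filter_upwards [g.ae_mem hΩ] with p hp
    exact hexpr p hp
  have hf1 := ((hL2 0).const_smul (a 0)).add ((hL2 1).const_smul (a 1))
  -- With $f=a_0h_0+a_1h_1$ in the domain of the closure, `h1` and `h2` compute $\int h_i\,\overline
  -- A f$ in two ways. Equating them gives $[h_i,f]=0$, which is expanded by linearity.
  have hpair : ∀ i, a 0 * ∫ p, (g.curvatureLaplacianExpr c (h i) p * h 0 p
        - h i p * g.curvatureLaplacianExpr c (h 0) p) ∂g.vol
      + a 1 * ∫ p, (g.curvatureLaplacianExpr c (h i) p * h 1 p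
        - h i p * g.curvatureLaplacianExpr c (h 1) p) ∂g.vol = 0 := by
    intro i
    have h1 := g.integral_closure hΩ c (hh i) (hL2 i) (hE i) ⟨_, ha⟩
    have h2 := g.integral_mul_closure hΩ c hf hf1 hf2 (hL2 i) hη hη1 hlim (htest i) ⟨_, ha⟩ rfl
    have i1 : ∀ j, Integrable (fun p => g.curvatureLaplacianExpr c (h i) p * h j p) g.vol :=
      fun j => (hE i).integrable_mul (hL2 j)
    have i2 : ∀ j, Integrable (fun p => h i p * g.curvatureLaplacianExpr c (h j) p) g.vol :=
      fun j => (hL2 i).integrable_mul (hE j)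
    have h3 : ∫ p, g.curvatureLaplacianExpr c (h i) p *
        (hf1.toLp (a 0 • h 0 + a 1 • h 1)) p ∂g.vol
        = ∫ p, (a 0 * (g.curvatureLaplacianExpr c (h i) p * h 0 p)
          + a 1 * (g.curvatureLaplacianExpr c (h i) p * h 1 p)) ∂g.vol := by
      refine integral_congr_ae ?_
      filter_upwards [hf1.coeFn_toLp] with p hp
      rw [hp]
      simp only [Pi.add_apply, Pi.smul_apply, smul_eq_mul]
      ring
    have h4 : ∫ p, h i p * g.curvatureLaplacianExpr c (a 0 • h 0 + a 1 • h 1) p ∂g.vol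
        = ∫ p, (a 0 * (h i p * g.curvatureLaplacianExpr c (h 0) p)
          + a 1 * (h i p * g.curvatureLaplacianExpr c (h 1) p)) ∂g.vol := by
      refine integral_congr_ae ?_
      filter_upwards [g.ae_mem hΩ] with p hp
      rw [hexpr p hp]
      ring
    have h5 := h1.symm.trans h2
    rw [h4] at h5
    have h6 := h3.symm.trans h5
    rw [integral_add ((i1 0).const_mul _) ((i1 1).const_mul _),
      integral_add ((i2 0).const_mul _) ((i2 1).const_mul _), integral_const_mul,
      integral_const_mul, integral_const_mul, integral_const_mul] at h6
    rw [integral_sub (i1 0) (i2 0), integral_sub (i1 1) (i2 1)]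
    linear_combination h6
  have hself : ∀ i, ∫ p, (g.curvatureLaplacianExpr c (h i) p * h i p
        - h i p * g.curvatureLaplacianExpr c (h i) p) ∂g.vol = 0 := fun i => by
    simp [mul_comm]
  have hanti : ∫ p, (g.curvatureLaplacianExpr c (h 1) p * h 0 p
        - h 1 p * g.curvatureLaplacianExpr c (h 0) p) ∂g.vol =
      -∫ p, (g.curvatureLaplacianExpr c (h 0) p * h 1 p
        - h 0 p * g.curvatureLaplacianExpr c (h 1) p) ∂g.vol := by
    rw [← integral_neg]
    refine integral_congr_ae (Eventually.of_forall fun p => ?_)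
    simp only
    ring
  -- Since the pairing is antisymmetric, $i=0$ leaves only $a_1[h_0,h_1]=0$ and $i=1$ only
  -- $-a_0[h_0,h_1]=0$.
  have p0 := hpair 0
  have p1 := hpair 1
  rw [hself, mul_zero, zero_add] at p0
  rw [hself, mul_zero, add_zero, hanti] at p1
  intro i
  fin_cases i
  · exact (mul_eq_zero.mp p1).resolve_right (neg_ne_zero.mpr hI)
  · exact (mul_eq_zero.mp p0).resolve_right hI

/-- Green's formula exhibits the differential expression applied to `h` as the value of the adjoint;
for real `h` no conjugate appears. Membership for the closure is recorded separately, so that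
non-self-adjointness follows without comparing $A^*$ and $(\overline A)^*$. -/
theorem mem_adjoint_domain (hΩ : IsOpen Ω) (c : ℝ) {h : Cylinder → ℂ} (hstar : star h = h)
    (hh : SmoothOn Ω h) (h1 : MemLp h 2 g.vol)
    (h2 : MemLp (g.curvatureLaplacianExpr c h) 2 g.vol) :
    h1.toLp h ∈ (g.curvatureLaplacian hΩ c).adjoint.domain ∧
      h1.toLp h ∈ (g.curvatureLaplacian hΩ c).closure.adjoint.domain := by
  have h3 : MemLp (star h) 2 g.vol := h1.star
  have key := g.inner_curvatureLaplacian hΩ c hh h3 h2.star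
  have e : h3.toLp (star h) = h1.toLp h := by
    rw [MemLp.toLp_eq_toLp_iff, hstar]
  rw [← e]
  exact ⟨LinearPMap.mem_adjoint_domain_of_exists _ ⟨_, fun x => (key x).symm⟩,
    LinearPMap.mem_adjoint_domain_of_exists _
      ⟨_, fun x => (LinearPMap.inner_closure_eq key x).symm⟩⟩

end RiemannianMetric


theorem pd_const {E : Type*} [NormedAddCommGroup E] [NormedSpace ℝ E] (i : Fin 2) (a : E)
    (p : Cylinder) : pd i (fun _ => a) p = 0 := by
  fin_cases i <;> simp [pd]

/-! ### Curvature and Laplacian of the metric in coordinates -/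

section Metric

variable {φ : Cylinder → ℝ} (hφ : SmoothOn univ φ) (s : Side)

/-- The coefficient `g_{yy}` of the metric. -/
def coeffYY (φ : Cylinder → ℝ) (p : Cylinder) : ℝ := (p.1 ^ 2)⁻¹ * Real.exp (-2 * φ p)

/-- The logarithmic derivative `-1/x - ∂ₓφ` of the density of the volume. -/
def logDeriv (φ : Cylinder → ℝ) (p : Cylinder) : ℝ := -p.1⁻¹ - pd 0 φ p

theorem metric_coeff_zero_zero (p : Cylinder) : (metric φ hφ s).coeff p 0 0 = 1 := by
  simp [metric]

theorem metric_coeff_zero_one (p : Cylinder) : (metric φ hφ s).coeff p 0 1 = 0 := by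
  simp [metric]

theorem metric_coeff_one_zero (p : Cylinder) : (metric φ hφ s).coeff p 1 0 = 0 := by
  simp [metric]

theorem metric_coeff_one_one (p : Cylinder) : (metric φ hφ s).coeff p 1 1 = coeffYY φ p := by
  simp [metric, coeffYY]

theorem metric_det (p : Cylinder) : ((metric φ hφ s).coeff p).det = coeffYY φ p := by
  rw [Matrix.det_fin_two, metric_coeff_zero_zero, metric_coeff_zero_one, metric_coeff_one_one]
  ring

variable {s} {p : Cylinder}

theorem coeffYY_pos (φ : Cylinder → ℝ) (hp : p.1 ≠ 0) : 0 < coeffYY φ p :=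
  mul_pos (inv_pos.mpr (by positivity)) (Real.exp_pos _)

theorem metric_inv_zero_zero (hp : p ∈ s.region) : (metric φ hφ s).inv 0 0 p = 1 := by
  have h := (coeffYY_pos φ (Side.ne_zero hp)).ne'
  simp only [RiemannianMetric.inv, Matrix.inv_def, metric_det, Ring.inverse_eq_inv',
    Matrix.smul_apply, Matrix.adjugate_fin_two, smul_eq_mul, metric_coeff_one_one]
  simp [h]

theorem metric_inv_one_one : (metric φ hφ s).inv 1 1 p = (coeffYY φ p)⁻¹ := by
  simp only [RiemannianMetric.inv, Matrix.inv_def, metric_det, Ring.inverse_eq_inv',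
    Matrix.smul_apply, Matrix.adjugate_fin_two, smul_eq_mul, metric_coeff_zero_zero]
  simp

theorem metric_inv_zero_one : (metric φ hφ s).inv 0 1 p = 0 := by
  simp only [RiemannianMetric.inv, Matrix.inv_def, metric_det, Ring.inverse_eq_inv',
    Matrix.smul_apply, Matrix.adjugate_fin_two, smul_eq_mul, metric_coeff_zero_one]
  simp

theorem metric_inv_one_zero : (metric φ hφ s).inv 1 0 p = 0 := by
  simp only [RiemannianMetric.inv, Matrix.inv_def, metric_det, Ring.inverse_eq_inv',
    Matrix.smul_apply, Matrix.adjugate_fin_two, smul_eq_mul, metric_coeff_one_zero]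
  simp

theorem metric_volDensity : (metric φ hφ s).volDensity p = √(coeffYY φ p) := by
  rw [RiemannianMetric.volDensity, metric_det]

theorem volDensity_eq : (metric φ hφ s).volDensity p = |p.1|⁻¹ * Real.exp (-φ p) := by
  rw [metric_volDensity, coeffYY, Real.sqrt_mul (by positivity), Real.sqrt_inv, Real.sqrt_sq_eq_abs,
    show -2 * φ p = -φ p + -φ p by ring, Real.exp_add, Real.sqrt_mul_self (Real.exp_pos _).le]

include hφ

theorem pd_zero_coeffYY (hp : p.1 ≠ 0) : pd 0 (coeffYY φ) p = 2 * logDeriv φ p * coeffYY φ p := by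
  apply pd_zero_eq
  have h1 := hφ.hasDerivAt_fst isOpen_univ (mem_univ p)
  have h2 := ((((hasDerivAt_id p.1).pow 2).inv (pow_ne_zero 2 hp)).mul ((h1.const_mul (-2)).exp))
  refine h2.congr_deriv ?_
  simp only [coeffYY, logDeriv, Pi.inv_apply, Pi.pow_apply, id]
  field_simp
  ring

theorem pd_one_coeffYY : pd 1 (coeffYY φ) p = -2 * pd 1 φ p * coeffYY φ p := by
  have h1 := hφ.hasDerivAt_one isOpen_univ (mem_univ p)
  have h2 := ((h1.const_mul (-2)).exp).const_mul (p.1 ^ 2)⁻¹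
  refine h2.deriv.trans ?_
  simp only [coeffYY, QuotientAddGroup.mk_zero, add_zero]
  ring

theorem smoothOn_logDeriv : SmoothOn s.region (logDeriv φ) :=
  (SmoothOn.neg (SmoothOn.inv (a := fun p : Cylinder => p.1) contDiff_fst.contDiffOn
    fun _ hp => Side.ne_zero hp)).sub ((hφ.pd isOpen_univ 0).mono (subset_univ _))

theorem smoothOn_coeffYY : SmoothOn s.region (coeffYY φ) := by
  have := (metric φ hφ s).smooth 1 1
  exact this.congr fun p _ => (metric_coeff_one_one hφ s p).symm

theorem pd_zero_logDeriv (hp : p.1 ≠ 0) :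
    pd 0 (logDeriv φ) p = (p.1 ^ 2)⁻¹ - pd 0 (pd 0 φ) p := by
  apply pd_zero_eq
  have h1 := (hφ.pd isOpen_univ 0).hasDerivAt_fst isOpen_univ (mem_univ p)
  have h2 := ((hasDerivAt_id p.1).inv hp).neg.sub h1
  refine h2.congr_deriv ?_
  simp only [id]
  field_simp

/-- For $dx^2+G\,dy^2$ one has $K=-(\sqrt G)_{xx}/\sqrt G$, which equals $-L_x-L^2$ for
$L=(\log\sqrt G)_x$. The symbol $\Gamma^1_{11}$ is not computed, since it enters only multiplied by
$\Gamma^0_{01}=0$. -/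
theorem gaussCurvature_metric (hp : p ∈ s.region) : (metric φ hφ s).gaussCurvature p =
    -pd 0 (logDeriv φ) p - logDeriv φ p ^ 2 := by
  have hG := (coeffYY_pos φ (Side.ne_zero hp)).ne'
  have c011 : (metric φ hφ s).christoffel 0 1 1 =ᶠ[𝓝 p]
      fun q => (-logDeriv φ q) * coeffYY φ q := by
    filter_upwards [s.isOpen_region.mem_nhds hp] with q hq
    simp only [RiemannianMetric.christoffel, Fin.sum_univ_two, metric_coeff_one_zero,
      metric_coeff_one_one, metric_inv_zero_one, metric_inv_zero_zero hφ hq, pd_const]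
    have := pd_zero_coeffYY hφ (Side.ne_zero hq)
    change pd 0 (fun q => coeffYY φ q) q = _ at this
    linear_combination (-1 / 2) * this
  have c001 : (metric φ hφ s).christoffel 0 0 1 = fun _ => 0 := by
    funext q
    simp only [RiemannianMetric.christoffel, Fin.sum_univ_two, metric_coeff_zero_zero,
      metric_coeff_zero_one, metric_coeff_one_zero, metric_coeff_one_one, metric_inv_zero_one,
      pd_const]
    ring
  have c010 : (metric φ hφ s).christoffel 0 1 0 p = 0 := by
    simp only [RiemannianMetric.christoffel, Fin.sum_univ_two, metric_coeff_zero_zero,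
      metric_coeff_zero_one, metric_coeff_one_zero, metric_coeff_one_one, metric_inv_zero_one,
      pd_const]
    ring
  have c000 : (metric φ hφ s).christoffel 0 0 0 p = 0 := by
    simp only [RiemannianMetric.christoffel, Fin.sum_univ_two, metric_coeff_zero_zero,
      metric_coeff_zero_one, metric_inv_zero_one, pd_const]
    ring
  have c101 : (metric φ hφ s).christoffel 1 0 1 p = logDeriv φ p := by
    simp only [RiemannianMetric.christoffel, Fin.sum_univ_two, metric_coeff_zero_zero,
      metric_coeff_zero_one, metric_coeff_one_zero, metric_coeff_one_one, metric_inv_one_zero,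
      metric_inv_one_one, pd_const]
    have := pd_zero_coeffYY hφ (Side.ne_zero hp)
    change pd 0 (fun q => coeffYY φ q) p = _ at this
    rw [this]
    field_simp
    ring
  have hmul := pd_mul s.isOpen_region (smoothOn_logDeriv (s := s) hφ).neg (smoothOn_coeffYY hφ) 0 hp
  have hneg : pd 0 (fun q => -logDeriv φ q) p = -pd 0 (logDeriv φ) p := by
    have := pd_comp_clm (-ContinuousLinearMap.id ℝ ℝ) s.isOpen_region
      (smoothOn_logDeriv (s := s) hφ) 0 hp
    simpa using this
  have r : (metric φ hφ s).riemann 0 1 0 1 p =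
      -(pd 0 (logDeriv φ) p + logDeriv φ p ^ 2) * coeffYY φ p := by
    rw [RiemannianMetric.riemann, pd_congr 0 c011, hmul, hneg, c001, pd_const, Fin.sum_univ_two, congr_fun c001 p,
      c000, c010, c101, c011.self_of_nhds, pd_zero_coeffYY hφ (Side.ne_zero hp)]
    ring
  rw [RiemannianMetric.gaussCurvature, Fin.sum_univ_two, metric_coeff_zero_zero,
    metric_coeff_zero_one, metric_det, r]
  field_simp
  ring

/-- Obtained by differentiating $\rho^2=g_{yy}$, which avoids the derivative of the square root. -/
theorem pd_volDensity (i : Fin 2) (hp : p ∈ s.region) : pd i ((metric φ hφ s).volDensity) p =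
    (2 * coeffYY φ p)⁻¹ * pd i (coeffYY φ) p * (metric φ hφ s).volDensity p := by
  have hG := coeffYY_pos φ (Side.ne_zero hp)
  have h1 := pd_mul s.isOpen_region (metric φ hφ s).smoothOn_volDensity
    (metric φ hφ s).smoothOn_volDensity i hp
  have h2 : pd i (fun q => (metric φ hφ s).volDensity q * (metric φ hφ s).volDensity q) p
      = pd i (coeffYY φ) p := by
    refine pd_congr i ?_
    filter_upwards [s.isOpen_region.mem_nhds hp] with q hq
    rw [metric_volDensity, Real.mul_self_sqrt (coeffYY_pos φ (Side.ne_zero hq)).le]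
  have h3 : coeffYY φ p = (metric φ hφ s).volDensity p * (metric φ hφ s).volDensity p := by
    rw [metric_volDensity, Real.mul_self_sqrt hG.le]
  have h4 := ((metric φ hφ s).volDensity_pos hp).ne'
  rw [← h2, h1, h3]
  field_simp
  ring

theorem grad_zero (u : Cylinder → ℂ) (hp : p ∈ s.region) :
    (metric φ hφ s).grad u 0 p = pd 0 u p := by
  rw [RiemannianMetric.grad, Fin.sum_univ_two, metric_inv_zero_zero hφ hp, metric_inv_zero_one]
  simp

theorem grad_one (u : Cylinder → ℂ) :
    (metric φ hφ s).grad u 1 p = (coeffYY φ p)⁻¹ • pd 1 u p := by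
  rw [RiemannianMetric.grad, Fin.sum_univ_two, metric_inv_one_one, metric_inv_one_zero]
  simp

theorem laplaceBeltrami_metric {u : Cylinder → ℂ} (hu : SmoothOn s.region u) (hp : p ∈ s.region) :
    (metric φ hφ s).laplaceBeltrami u p = pd 0 (pd 0 u) p + logDeriv φ p * pd 0 u p
      + (coeffYY φ p)⁻¹ * (pd 1 (pd 1 u) p + pd 1 φ p * pd 1 u p) := by
  have hΩ := s.isOpen_region
  have hG : (coeffYY φ p : ℂ) ≠ 0 := by exact_mod_cast (coeffYY_pos φ (Side.ne_zero hp)).ne'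
  have hρ : ((metric φ hφ s).volDensity p : ℂ) ≠ 0 := by
    exact_mod_cast ((metric φ hφ s).volDensity_pos hp).ne'
  have e0 : pd 0 (fun q => (metric φ hφ s).volDensity q • (metric φ hφ s).grad u 0 q) p =
      pd 0 (fun q => (metric φ hφ s).volDensity q • pd 0 u q) p := by
    refine pd_congr 0 ?_
    filter_upwards [hΩ.mem_nhds hp] with q hq
    rw [grad_zero hφ u hq]
  have hGinv : SmoothOn s.region (fun q => (coeffYY φ q)⁻¹) :=
    (smoothOn_coeffYY hφ).inv fun q hq => (coeffYY_pos φ (Side.ne_zero hq)).ne'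
  have e1 : pd 1 (fun q => (coeffYY φ q)⁻¹) p = 2 * pd 1 φ p * (coeffYY φ p)⁻¹ := by
    have h1 := pd_mul hΩ hGinv (smoothOn_coeffYY hφ) 1 hp
    have h2 : pd 1 (fun q => (coeffYY φ q)⁻¹ * coeffYY φ q) p = 0 := by
      rw [← pd_const 1 (1 : ℝ) p]
      refine pd_congr 1 ?_
      filter_upwards [hΩ.mem_nhds hp] with q hq
      exact inv_mul_cancel₀ (coeffYY_pos φ (Side.ne_zero hq)).ne'
    have h3 : coeffYY φ p ≠ 0 := (coeffYY_pos φ (Side.ne_zero hp)).ne'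
    rw [h2, pd_one_coeffYY hφ] at h1
    field_simp at h1 ⊢
    linarith
  simp only [RiemannianMetric.laplaceBeltrami, RiemannianMetric.div, Fin.sum_univ_two, e0,
    grad_one]
  rw [pd_smul hΩ (metric φ hφ s).smoothOn_volDensity (hu.pd hΩ 0) 0 hp,
    pd_smul hΩ (metric φ hφ s).smoothOn_volDensity (hGinv.smul (hu.pd hΩ 1)) 1 hp,
    pd_smul hΩ hGinv (hu.pd hΩ 1) 1 hp, e1, pd_volDensity hφ 0 hp, pd_volDensity hφ 1 hp,
    pd_zero_coeffYY hφ (Side.ne_zero hp), pd_one_coeffYY hφ]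
  simp only [Complex.real_smul]
  push_cast
  field_simp
  ring

/-- The differential expression `-Δ + cK` in the coordinates `(x, y)`. -/
theorem expr_metric (c : ℝ) {u : Cylinder → ℂ} (hu : SmoothOn s.region u) (hp : p ∈ s.region) :
    (metric φ hφ s).curvatureLaplacianExpr c u p =
      -(pd 0 (pd 0 u) p - ((p.1⁻¹ + pd 0 φ p : ℝ) : ℂ) * pd 0 u p
        + ((p.1 ^ 2 * Real.exp (2 * φ p) : ℝ) : ℂ) * (pd 1 (pd 1 u) p + pd 1 φ p * pd 1 u p))
      + ((c * (-(2 * (p.1 ^ 2)⁻¹) - 2 * p.1⁻¹ * pd 0 φ p + pd 0 (pd 0 φ) p - pd 0 φ p ^ 2) : ℝ) : ℂ)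
        * u p := by
  have hx := Side.ne_zero hp
  have hG : (coeffYY φ p)⁻¹ = p.1 ^ 2 * Real.exp (2 * φ p) := by
    rw [coeffYY, mul_inv, inv_inv, ← Real.exp_neg]
    ring_nf
  have hK : -pd 0 (logDeriv φ) p - logDeriv φ p ^ 2 =
      -(2 * (p.1 ^ 2)⁻¹) - 2 * p.1⁻¹ * pd 0 φ p + pd 0 (pd 0 φ) p - pd 0 φ p ^ 2 := by
    rw [pd_zero_logDeriv hφ hx, logDeriv]
    field_simp
    ring
  rw [RiemannianMetric.curvatureLaplacianExpr, laplaceBeltrami_metric hφ hu hp,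
    gaussCurvature_metric hφ hp, hK, Complex.real_smul, hG, logDeriv]
  push_cast
  ring

end Metric


/-! ### The radial Euler equation and its inhomogeneous solution -/

/-- `a` is smooth on `(0, ∞)` with first and second derivatives `a₁` and `a₂`. -/
structure IsRadial (a a₁ a₂ : ℝ → ℝ) : Prop where
  contDiffOn : ContDiffOn ℝ ∞ a (Ioi 0)
  hasDerivAt : ∀ r, 0 < r → HasDerivAt a (a₁ r) r
  hasDerivAt' : ∀ r, 0 < r → HasDerivAt a₁ (a₂ r) r

theorem contDiffOn_rpow (q : ℝ) : ContDiffOn ℝ ∞ (fun r : ℝ => r ^ q) (Ioi 0) := fun _ hr =>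
  (Real.contDiffAt_rpow_const_of_ne (ne_of_gt hr)).contDiffWithinAt

theorem hasDerivAt_const_mul_rpow (C q : ℝ) {r : ℝ} (hr : 0 < r) :
    HasDerivAt (fun r : ℝ => C * r ^ q) (C * (q * r ^ (q - 1))) r :=
  (Real.hasDerivAt_rpow_const (Or.inl hr.ne')).const_mul C

theorem isRadial_rpow (q : ℝ) : IsRadial (fun r => r ^ q) (fun r => q * r ^ (q - 1))
    (fun r => q * ((q - 1) * r ^ (q - 1 - 1))) where
  contDiffOn := contDiffOn_rpow q
  hasDerivAt _ hr := Real.hasDerivAt_rpow_const (Or.inl hr.ne')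
  hasDerivAt' _ hr := hasDerivAt_const_mul_rpow q (q - 1) hr

/-- A primitive of `-r^{-q}` on `(0, ∞)` which vanishes at `1`. -/
theorem exists_primitive_rpow (q : ℝ) : ∃ G : ℝ → ℝ, ContDiffOn ℝ ∞ G (Ioi 0) ∧
    (∀ r, 0 < r → HasDerivAt G (-r ^ (-q)) r) ∧ G 1 = 0 := by
  by_cases hq : q = 1
  · refine ⟨fun r => -Real.log r, (Real.contDiffOn_log.mono fun r hr => ne_of_gt hr).neg,
      fun r hr => ?_, by simp⟩
    rw [hq, Real.rpow_neg_one]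
    exact (Real.hasDerivAt_log hr.ne').neg
  · have hq' : 1 - q ≠ 0 := fun h => hq (by linarith)
    refine ⟨fun r => (1 - q)⁻¹ - (1 - q)⁻¹ * r ^ (1 - q),
      contDiffOn_const.sub (contDiffOn_const.mul (contDiffOn_rpow _)), fun r hr => ?_, by simp⟩
    refine ((hasDerivAt_const_mul_rpow (1 - q)⁻¹ (1 - q) hr).const_sub _).congr_deriv ?_
    rw [show 1 - q - 1 = -q by ring]
    field_simp

/-- On $(0,1]$ both $G$ and $\mu^{-1}t^{-\mu}-G$ are decreasing, the latter because $t^{-q}\le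
t^{-\mu-1}$ there. Their values at $1$ are $0$ and $\mu^{-1}>0$. The bound treats powers and the
logarithm alike. -/
theorem abs_primitive_le {q μ : ℝ} (hμ : 0 < μ) (hq : q ≤ 1 + μ) {G : ℝ → ℝ}
    (hG : ∀ r, 0 < r → HasDerivAt G (-r ^ (-q)) r) (hG1 : G 1 = 0) {r : ℝ} (hr : 0 < r)
    (hr1 : r ≤ 1) : |G r| ≤ μ⁻¹ * r ^ (-μ) := by
  have hcont : ContinuousOn G (Ioc 0 1) := fun t ht => (hG t ht.1).continuousAt.continuousWithinAt
  have hM : ∀ t, 0 < t → HasDerivAt (fun t => μ⁻¹ * t ^ (-μ)) (-t ^ (-μ - 1)) t := fun t ht => by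
    refine (hasDerivAt_const_mul_rpow μ⁻¹ (-μ) ht).congr_deriv ?_
    field_simp
  have h1 : AntitoneOn G (Ioc 0 1) := by
    refine antitoneOn_of_deriv_nonpos (convex_Ioc 0 1) hcont ?_ ?_
    · rw [interior_Ioc]
      exact fun t ht => (hG t ht.1).differentiableAt.differentiableWithinAt
    · rw [interior_Ioc]
      intro t ht
      rw [(hG t ht.1).deriv]
      exact neg_nonpos.mpr (Real.rpow_nonneg ht.1.le _)
  have h2 : AntitoneOn (fun t => μ⁻¹ * t ^ (-μ) - G t) (Ioc 0 1) := by
    have hd : ∀ t, 0 < t → HasDerivAt (fun t => μ⁻¹ * t ^ (-μ) - G t)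
      (-t ^ (-μ - 1) - -t ^ (-q)) t := fun t ht => (hM t ht).sub (hG t ht)
    refine antitoneOn_of_deriv_nonpos (convex_Ioc 0 1)
      (fun t ht => (hd t ht.1).continuousAt.continuousWithinAt) ?_ ?_
    · rw [interior_Ioc]
      exact fun t ht => (hd t ht.1).differentiableAt.differentiableWithinAt
    · rw [interior_Ioc]
      intro t ht
      rw [(hd t ht.1).deriv]
      have : t ^ (-q) ≤ t ^ (-μ - 1) :=
        Real.rpow_le_rpow_of_exponent_ge ht.1 ht.2.le (by linarith)
      linarith
  have h3 := h1 ⟨hr, hr1⟩ (right_mem_Ioc.mpr one_pos) hr1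
  have h4 := h2 ⟨hr, hr1⟩ (right_mem_Ioc.mpr one_pos) hr1
  simp only [hG1, Real.one_rpow, mul_one, sub_zero] at h3 h4
  rw [abs_of_nonneg h3]
  have : 0 < μ⁻¹ := inv_pos.mpr hμ
  linarith

/-- The radial part of the second order term of the solution with exponent `1 - ν`. -/
theorem exists_radialCorrection {ν : ℝ} (h0 : 0 < ν) (h1 : ν < 1) :
    ∃ F F₁ F₂ : ℝ → ℝ, IsRadial F F₁ F₂ ∧
      (∀ r, 0 < r → -F₂ r + F₁ r / r - (1 - ν ^ 2) * F r / r ^ 2 = r ^ (-ν)) ∧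
      (∀ r, 0 < r → (1 + ν) * r ^ ν * F r - r ^ (1 + ν) * F₁ r = r ^ 2) ∧
      ∃ C, 0 ≤ C ∧ ∀ r, 0 < r → r ≤ 1 →
        |F r| ≤ C * r ^ (1 + ν * (1 - ν)) ∧ |F₁ r| ≤ C * r ^ (ν * (1 - ν)) := by
  -- Reduction of order: for $F=r^{1+\nu}G$ the equation becomes
  -- $-r^{1+\nu}G''-(1+2\nu)r^{\nu}G'=r^{-\nu}$, solved by $G'=-r^{-2\nu}$. At the resonance
  -- $\nu=1/2$ this makes $G$ a logarithm.
  obtain ⟨G, hGs, hG, hG1⟩ := exists_primitive_rpow (2 * ν)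
  have hp : ∀ r : ℝ, 0 < r → r ^ (1 + ν) = r * r ^ ν := fun r hr => by
    rw [Real.rpow_add hr, Real.rpow_one]
  have hn : ∀ r : ℝ, 0 < r → r ^ (1 - ν) = r * (r ^ ν)⁻¹ := fun r hr => by
    rw [Real.rpow_sub hr, Real.rpow_one, div_eq_mul_inv]
  refine ⟨fun r => r ^ (1 + ν) * G r, fun r => (1 + ν) * r ^ ν * G r - r ^ (1 - ν),
    fun r => (1 + ν) * (ν * r ^ (ν - 1)) * G r - (1 + ν) * r ^ (-ν) - (1 - ν) * r ^ (-ν),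
    ⟨(contDiffOn_rpow _).mul hGs, fun r hr => ?_, fun r hr => ?_⟩, fun r hr => ?_, fun r hr => ?_,
    (1 + ν) * (ν ^ 2)⁻¹ + 1, by positivity, fun r hr hr1 => ?_⟩
  · refine ((Real.hasDerivAt_rpow_const (p := 1 + ν) (Or.inl hr.ne')).mul
      (hG r hr)).congr_deriv ?_
    rw [show 1 + ν - 1 = ν by ring, mul_neg, ← Real.rpow_add hr,
      show 1 + ν + -(2 * ν) = 1 - ν by ring]
    ring
  · refine (((hasDerivAt_const_mul_rpow (1 + ν) ν hr).mul (hG r hr)).sub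
      (Real.hasDerivAt_rpow_const (p := 1 - ν) (Or.inl hr.ne'))).congr_deriv ?_
    rw [show 1 - ν - 1 = -ν by ring, show -ν = ν + -(2 * ν) by ring, Real.rpow_add hr]
    ring
  · have hν : r ^ ν ≠ 0 := (Real.rpow_pos_of_pos hr ν).ne'
    have e1 : r ^ (ν - 1) = r ^ ν / r := by rw [Real.rpow_sub hr, Real.rpow_one]
    simp only [hp r hr, hn r hr, e1, Real.rpow_neg hr.le]
    field_simp
    ring
  · have hν : r ^ ν ≠ 0 := (Real.rpow_pos_of_pos hr ν).ne'
    simp only [hp r hr, hn r hr]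
    field_simp
    ring
  -- The choice $\mu=\nu^2$ is admissible since $2\nu\le1+\nu^2$. It leaves $F=O(r^{1+\nu-\nu^2})$,
  -- with exponent $1+\nu(1-\nu)>1$.
  · have hb := abs_primitive_le (q := 2 * ν) (μ := ν ^ 2) (by positivity)
      (by nlinarith [sq_nonneg (1 - ν)]) hG hG1 hr hr1
    have k1 : r ^ (1 + ν) * r ^ (-ν ^ 2) = r ^ (1 + ν * (1 - ν)) := by
      rw [← Real.rpow_add hr]; ring_nf
    have k2 : r ^ ν * r ^ (-ν ^ 2) = r ^ (ν * (1 - ν)) := by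
      rw [← Real.rpow_add hr]; ring_nf
    have k3 : r ^ (1 - ν) ≤ r ^ (ν * (1 - ν)) :=
      Real.rpow_le_rpow_of_exponent_ge hr hr1 (by nlinarith)
    have pos : ∀ q : ℝ, 0 < r ^ q := fun q => Real.rpow_pos_of_pos hr q
    have hν2 : 0 < (ν ^ 2)⁻¹ := by positivity
    constructor
    · rw [abs_mul, abs_of_pos (pos _)]
      calc r ^ (1 + ν) * |G r| ≤ r ^ (1 + ν) * ((ν ^ 2)⁻¹ * r ^ (-ν ^ 2)) := by gcongr
        _ = (ν ^ 2)⁻¹ * r ^ (1 + ν * (1 - ν)) := by rw [← k1]; ring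
        _ ≤ ((1 + ν) * (ν ^ 2)⁻¹ + 1) * r ^ (1 + ν * (1 - ν)) := by
          have := pos (1 + ν * (1 - ν))
          gcongr
          nlinarith
    · calc |(1 + ν) * r ^ ν * G r - r ^ (1 - ν)|
          ≤ |(1 + ν) * r ^ ν * G r| + |r ^ (1 - ν)| := abs_sub _ _
        _ = (1 + ν) * r ^ ν * |G r| + r ^ (1 - ν) := by
          rw [abs_mul, abs_of_pos (pos (1 - ν)), abs_of_pos (by have := pos ν; positivity)]
        _ ≤ (1 + ν) * r ^ ν * ((ν ^ 2)⁻¹ * r ^ (-ν ^ 2)) + r ^ (ν * (1 - ν)) := by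
          have := pos ν
          gcongr
        _ = ((1 + ν) * (ν ^ 2)⁻¹ + 1) * r ^ (ν * (1 - ν)) := by rw [← k2]; ring

/-! ### Uniform bounds near the singular circle -/

theorem exists_bound_of_smoothOn {f : Cylinder → ℝ} (hf : SmoothOn univ f) :
    ∃ C, 0 ≤ C ∧ ∀ p : Cylinder, |p.1| ≤ 1 → |f p| ≤ C := by
  have hK : IsCompact (Icc (-1 : ℝ) 1 ×ˢ (univ : Set (AddCircle (2 * Real.pi)))) :=
    isCompact_Icc.prod isCompact_univ
  obtain ⟨C, hC⟩ := hK.exists_bound_of_continuousOn hf.continuous.continuousOn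
  refine ⟨C, (norm_nonneg _).trans (hC (0, 0) (by simp)), fun p hp => hC p ⟨?_, mem_univ _⟩⟩
  exact abs_le.mp hp

/-- The partial derivative in `x` is Lipschitz near the singular circle. -/
theorem exists_lipschitz_of_smoothOn {f : Cylinder → ℝ} (hf : SmoothOn univ f) :
    ∃ C, 0 ≤ C ∧ ∀ p : Cylinder, |p.1| ≤ 1 → |f p - f (0, p.2)| ≤ C * |p.1| := by
  obtain ⟨C, hC0, hC⟩ := exists_bound_of_smoothOn (hf.pd isOpen_univ 0)
  refine ⟨C, hC0, fun p hp => ?_⟩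
  have h := Convex.norm_image_sub_le_of_norm_hasDerivWithin_le
    (f := fun x : ℝ => f (x, p.2)) (f' := fun x => pd 0 f (x, p.2)) (s := Icc (-1 : ℝ) 1) (C := C)
    (x := 0) (y := p.1)
    (fun x _ => (hf.hasDerivAt_fst isOpen_univ (mem_univ (x, p.2))).hasDerivWithinAt)
    (fun x hx => hC (x, p.2) (abs_le.mpr hx)) (convex_Icc _ _) (by simp) (abs_le.mp hp)
  simpa using h


/-! ### Action of the operator on the ansatz $a(r)+b(y)F(r)$ -/

/-- The half-cylinder `{σ x > 0}`, where `σ = ±1`. -/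
def half (σ : ℝ) : Set Cylinder := {p | 0 < σ * p.1}

theorem isOpen_half (σ : ℝ) : IsOpen (half σ) :=
  isOpen_lt continuous_const (continuous_const.mul continuous_fst)

/-- The function `a(r) + b F(r)` on the half-cylinder, where `r = σ x`. -/
def ansatz (σ : ℝ) (a F : ℝ → ℝ) (b : Cylinder → ℝ) (p : Cylinder) : ℝ :=
  a (σ * p.1) + b p * F (σ * p.1)

section Ansatz

variable {σ : ℝ} {a a₁ a₂ F F₁ F₂ : ℝ → ℝ} {b : Cylinder → ℝ}

theorem smoothOn_ansatz (ha : IsRadial a a₁ a₂) (hF : IsRadial F F₁ F₂) (hb : SmoothOn univ b) :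
    SmoothOn (half σ) (ansatz σ a F b) := by
  have h : ∀ {f f₁ f₂ : ℝ → ℝ}, IsRadial f f₁ f₂ →
      SmoothOn (half σ) (fun p : Cylinder => f (σ * p.1)) := fun {f f₁ f₂} hf => by
    have h1 : ContDiffOn ℝ ∞ (fun x : ℝ => f (σ * x)) {x | 0 < σ * x} :=
      hf.contDiffOn.comp (contDiff_const.mul contDiff_id).contDiffOn fun x hx => hx
    exact SmoothOn.comp_fst h1 fun p hp => hp
  exact (h ha).add ((hb.mono (subset_univ _)).mul (h hF))

/-- As `b` depends on $y$ alone, $\partial_x$ only replaces the radial parts by their derivatives,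
with a factor $\sigma$. Only first derivatives are assumed, so the lemma applies again to `a₁`,
`F₁`. -/
theorem hasDerivAt_ansatz (hb : ∀ x x' y, b (x, y) = b (x', y))
    (ha : ∀ r, 0 < r → HasDerivAt a (a₁ r) r) (hF : ∀ r, 0 < r → HasDerivAt F (F₁ r) r)
    {p : Cylinder} (hp : p ∈ half σ) :
    HasDerivAt (fun x => ansatz σ a F b (x, p.2)) (σ * ansatz σ a₁ F₁ b p) p.1 := by
  have h1 : HasDerivAt (fun x : ℝ => σ * x) σ p.1 := by
    simpa using (hasDerivAt_id p.1).const_mul σ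
  have e : (fun x => ansatz σ a F b (x, p.2)) = fun x => a (σ * x) + b p * F (σ * x) := by
    funext x
    rw [ansatz, hb x p.1 p.2]
  rw [e]
  refine (((ha _ hp).comp p.1 h1).add (((hF _ hp).comp p.1 h1).const_mul (b p))).congr_deriv ?_
  rw [ansatz]
  ring

theorem pd_zero_ofReal {v : Cylinder → ℝ} {v' : ℝ} {p : Cylinder}
    (h : HasDerivAt (fun x => v (x, p.2)) v' p.1) : pd 0 (fun q => (v q : ℂ)) p = v' :=
  pd_zero_eq h.ofReal_comp

theorem pd_one_ansatz (hb : SmoothOn univ b) (p : Cylinder) :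
    pd 1 (fun q => (ansatz σ a F b q : ℂ)) p = (pd 1 b p * F (σ * p.1) : ℝ) := by
  have h1 := hb.hasDerivAt_one isOpen_univ (mem_univ p)
  exact (((h1.mul_const (F (σ * p.1))).const_add (a (σ * p.1))).ofReal_comp).deriv

theorem pd_one_mul_radial (hb : SmoothOn univ b) (p : Cylinder) :
    pd 1 (fun q => ((b q * F (σ * q.1) : ℝ) : ℂ)) p = (pd 1 b p * F (σ * p.1) : ℝ) := by
  have h1 := hb.hasDerivAt_one isOpen_univ (mem_univ p)
  exact ((h1.mul_const (F (σ * p.1))).ofReal_comp).deriv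

variable {φ : Cylinder → ℝ} (hφ : SmoothOn univ φ) {s : Side}

/-- The action of `-Δ + cK` on a function which agrees with the ansatz near a point. -/
theorem expr_ansatz (hσ : σ * σ = 1) (ha : IsRadial a a₁ a₂) (hF : IsRadial F F₁ F₂)
    (hb : SmoothOn univ b) (hb0 : ∀ x x' y, b (x, y) = b (x', y)) (c : ℝ) {u : Cylinder → ℂ}
    (hu : SmoothOn s.region u) {N : Set Cylinder} (hN : IsOpen N) (hNσ : N ⊆ half σ)
    (hNs : N ⊆ s.region) (huN : ∀ p ∈ N, u p = ansatz σ a F b p) {p : Cylinder} (hp : p ∈ N) :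
    (metric φ hφ s).curvatureLaplacianExpr c u p =
      ((((-a₂ (σ * p.1) + a₁ (σ * p.1) / (σ * p.1) - 2 * c * a (σ * p.1) / (σ * p.1) ^ 2)
        + b p * (-F₂ (σ * p.1) + F₁ (σ * p.1) / (σ * p.1) - 2 * c * F (σ * p.1) / (σ * p.1) ^ 2)
        + σ * pd 0 φ p * (a₁ (σ * p.1) - 2 * c * a (σ * p.1) / (σ * p.1)))
      + (σ * pd 0 φ p * b p * (F₁ (σ * p.1) - 2 * c * F (σ * p.1) / (σ * p.1))
        + c * (pd 0 (pd 0 φ) p - pd 0 φ p ^ 2) * (a (σ * p.1) + b p * F (σ * p.1))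
        - p.1 ^ 2 * Real.exp (2 * φ p) * (pd 1 (pd 1 b) p + pd 1 φ p * pd 1 b p) *
          F (σ * p.1)) : ℝ) : ℂ) := by
  have hloc : ∀ q ∈ N, u =ᶠ[𝓝 q] fun q => (ansatz σ a F b q : ℂ) := fun q hq => by
    filter_upwards [hN.mem_nhds hq] with q' hq' using huN q' hq'
  have u0 : ∀ q ∈ N, pd 0 u q = ((σ * ansatz σ a₁ F₁ b q : ℝ) : ℂ) := fun q hq => by
    rw [pd_congr 0 (hloc q hq),
      pd_zero_ofReal (hasDerivAt_ansatz hb0 ha.hasDerivAt hF.hasDerivAt (hNσ hq))]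
  have u00 : pd 0 (pd 0 u) p = ((σ * (σ * ansatz σ a₂ F₂ b p) : ℝ) : ℂ) := by
    have e : pd 0 u =ᶠ[𝓝 p] fun q => ((σ * ansatz σ a₁ F₁ b q : ℝ) : ℂ) := by
      filter_upwards [hN.mem_nhds hp] with q hq using u0 q hq
    rw [pd_congr 0 e, pd_zero_ofReal (v := fun q => σ * ansatz σ a₁ F₁ b q)
      ((hasDerivAt_ansatz hb0 ha.hasDerivAt' hF.hasDerivAt' (hNσ hp)).const_mul σ)]
  have u1 : ∀ q ∈ N, pd 1 u q = ((pd 1 b q * F (σ * q.1) : ℝ) : ℂ) := fun q hq => by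
    rw [pd_congr 1 (hloc q hq), pd_one_ansatz hb]
  have u11 : pd 1 (pd 1 u) p = ((pd 1 (pd 1 b) p * F (σ * p.1) : ℝ) : ℂ) := by
    have e : pd 1 u =ᶠ[𝓝 p] fun q => ((pd 1 b q * F (σ * q.1) : ℝ) : ℂ) := by
      filter_upwards [hN.mem_nhds hp] with q hq using u1 q hq
    rw [pd_congr 1 e, pd_one_mul_radial (hb.pd isOpen_univ 1)]
  rw [expr_metric hφ c hu (hNs hp), u00, u0 p hp, u11, u1 p hp, huN p hp]
  norm_cast
  have hσ0 : σ ≠ 0 := fun h => by simp [h] at hσ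
  have hx : p.1 ≠ 0 := Side.ne_zero (hNs hp)
  -- Since $\sigma^{-1}=\sigma$, passing from $x$ to $r=\sigma x$ leaves a factor $\sigma$ in odd
  -- powers and none in even ones.
  have hi : p.1⁻¹ = σ * (σ * p.1)⁻¹ := by
    field_simp
  have hi2 : (p.1 ^ 2)⁻¹ = ((σ * p.1) ^ 2)⁻¹ := by
    rw [mul_pow, pow_two σ, hσ, one_mul]
  simp only [ansatz, div_eq_mul_inv, hi, hi2]
  have hσ2 : σ ^ 2 = 1 := by rw [pow_two, hσ]
  ring_nf
  simp only [hσ2]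
  ring

end Ansatz

/-! ### Square integrability near the singular circle -/

section Integrability

variable {φ : Cylinder → ℝ} (hφ : SmoothOn univ φ) {s : Side} {σ : ℝ}

/-- Used with $q=2\kappa-1$: the square of an $O(r^\kappa)$ function, times a density of order
$r^{-1}$. -/
theorem integrable_radial (hσ : σ * σ = 1) {q : ℝ} (hq : -1 < q) :
    Integrable (fun p : Cylinder => (Ioc (0 : ℝ) 1).indicator (fun r => r ^ q) (σ * p.1)) := by
  have hσ0 : σ ≠ 0 := fun h => by simp [h] at hσ
  have h1 : Integrable ((Ioc (0 : ℝ) 1).indicator (fun r => r ^ q)) := by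
    rw [integrable_indicator_iff measurableSet_Ioc]
    exact (intervalIntegrable_iff_integrableOn_Ioc_of_le zero_le_one).mp
      (intervalIntegral.intervalIntegrable_rpow' hq)
  have h2 := h1.comp_mul_left' hσ0
  have h3 := h2.mul_prod (ν := (volume : Measure (AddCircle (2 * Real.pi))))
    (integrable_const (1 : ℝ))
  simpa [Measure.volume_eq_prod] using h3

/-- Functions which are `O(r^κ)` on the half-cylinder and vanish for `r > 2δ` are in `L²`. -/
theorem memLp_of_radial_bound (hσ : σ * σ = 1) {δ κ C : ℝ} (hδ : 0 < δ) (hδ1 : 2 * δ ≤ 1)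
    (hκ : 0 < κ) {w : Cylinder → ℂ} (hw : SmoothOn s.region w) (hσs : half σ ⊆ s.region)
    (h0 : ∀ p ∈ s.region, ¬ (0 < σ * p.1 ∧ σ * p.1 ≤ 2 * δ) → w p = 0)
    (hC : ∀ p : Cylinder, 0 < σ * p.1 → σ * p.1 < δ → ‖w p‖ ≤ C * (σ * p.1) ^ κ) :
    MemLp w 2 (metric φ hφ s).vol := by
  have hΩ := s.isOpen_region
  have hcont := hw.continuousOn hΩ
  have hσ0 : σ ≠ 0 := fun h => by simp [h] at hσ
  have habs : |σ| = 1 := by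
    have : |σ| * |σ| = 1 := by rw [← abs_mul, hσ, abs_one]
    nlinarith [abs_nonneg σ]
  have hK : IsCompact {p : Cylinder | δ ≤ σ * p.1 ∧ σ * p.1 ≤ 2 * δ} := by
    have : IsCompact (Icc (-1 : ℝ) 1 ×ˢ (univ : Set (AddCircle (2 * Real.pi)))) :=
      isCompact_Icc.prod isCompact_univ
    refine this.of_isClosed_subset ?_ ?_
    · exact (isClosed_le continuous_const (continuous_const.mul continuous_fst)).inter
        (isClosed_le (continuous_const.mul continuous_fst) continuous_const)
    · intro p hp
      refine ⟨abs_le.mp ?_, mem_univ _⟩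
      have : |σ * p.1| ≤ 1 := abs_le.mpr ⟨by linarith [hp.1], by linarith [hp.2]⟩
      rwa [abs_mul, habs, one_mul] at this
  obtain ⟨C₂, hC₂⟩ := hK.exists_bound_of_continuousOn
    (hcont.mono fun p hp => hσs (show 0 < σ * p.1 from hδ.trans_le hp.1))
  obtain ⟨B, hB0, hB⟩ := exists_bound_of_smoothOn hφ
  -- On the compact annulus $\delta\le r\le2\delta$ a constant bound $C_2$ becomes a multiple of
  -- $r^\kappa$, since $(r/\delta)^\kappa\ge1$ there.
  set M := |C| + |C₂| * δ⁻¹ ^ κ with hM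
  have hM0 : 0 ≤ M := by positivity
  have hbound : ∀ p : Cylinder, 0 < σ * p.1 → σ * p.1 ≤ 2 * δ → ‖w p‖ ≤ M * (σ * p.1) ^ κ := by
    intro p hp hp2
    have hpos : 0 < (σ * p.1) ^ κ := Real.rpow_pos_of_pos hp κ
    rcases lt_or_ge (σ * p.1) δ with h | h
    · refine (hC p hp h).trans ?_
      gcongr
      have : 0 ≤ |C₂| * δ⁻¹ ^ κ := by positivity
      linarith [le_abs_self C]
    · calc ‖w p‖ ≤ |C₂| * 1 := by simpa using (hC₂ p ⟨h, hp2⟩).trans (le_abs_self _)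
        _ ≤ |C₂| * (δ⁻¹ ^ κ * (σ * p.1) ^ κ) := by
          gcongr
          rw [← Real.mul_rpow (by positivity) hp.le]
          refine Real.one_le_rpow ?_ hκ.le
          rw [inv_mul_eq_div, one_le_div hδ]
          exact h
        _ ≤ M * (σ * p.1) ^ κ := by
          rw [← mul_assoc]
          gcongr
          linarith [abs_nonneg C]
  have hmeas : AEStronglyMeasurable w (volume.restrict s.region) :=
    hcont.aestronglyMeasurable hΩ.measurableSet
  have hmeas' : AEStronglyMeasurable w (metric φ hφ s).vol :=
    hmeas.mono_ac (withDensity_absolutelyContinuous _ _)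
  rw [memLp_two_iff_integrable_sq_norm hmeas', RiemannianMetric.vol,
    integrable_withDensity_iff_integrable_smul₀' ((metric φ hφ s).aemeasurable_density hΩ)
      (Eventually.of_forall fun _ => ENNReal.ofReal_lt_top)]
  refine Integrable.mono' (((integrable_radial (q := 2 * κ - 1) hσ (by linarith)).const_mul
    (Real.exp B * M ^ 2)).restrict) ?_ ?_
  · exact ((metric φ hφ s).aemeasurable_density hΩ).ennreal_toReal.aestronglyMeasurable.smul
      (hmeas.norm.pow 2)
  · filter_upwards [ae_restrict_mem hΩ.measurableSet] with p hp
    rw [ENNReal.toReal_ofReal ((metric φ hφ s).volDensity_pos hp).le]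
    by_cases hp' : 0 < σ * p.1 ∧ σ * p.1 ≤ 2 * δ
    · have hp1 : σ * p.1 ≤ 1 := hp'.2.trans hδ1
      have hxa : |p.1| = σ * p.1 := by
        rw [← abs_of_pos hp'.1, abs_mul, habs, one_mul]
      rw [indicator_of_mem (show σ * p.1 ∈ Ioc (0 : ℝ) 1 from ⟨hp'.1, hp1⟩), volDensity_eq, hxa,
        smul_eq_mul, Real.norm_of_nonneg (by have := hp'.1; positivity)]
      have e1 : Real.exp (-φ p) ≤ Real.exp B := by
        have := hB p (hxa ▸ hp1)
        exact Real.exp_le_exp.mpr (by linarith [neg_abs_le (φ p)])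
      have e2 : (σ * p.1) ^ (2 * κ - 1) = (σ * p.1)⁻¹ * ((σ * p.1) ^ κ) ^ 2 := by
        rw [Real.rpow_sub hp'.1, Real.rpow_one, div_eq_inv_mul, mul_comm 2 κ,
          Real.rpow_mul hp'.1.le, Real.rpow_two]
      have hpos := inv_pos.mpr hp'.1
      calc (σ * p.1)⁻¹ * Real.exp (-φ p) * ‖w p‖ ^ 2
          ≤ (σ * p.1)⁻¹ * Real.exp B * (M * (σ * p.1) ^ κ) ^ 2 := by
            have := hbound p hp'.1 hp'.2
            gcongr
        _ = Real.exp B * M ^ 2 * (σ * p.1) ^ (2 * κ - 1) := by rw [e2]; ring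
    · rw [h0 p hp hp']
      have : 0 ≤ (Ioc (0 : ℝ) 1).indicator (fun r => r ^ (2 * κ - 1)) (σ * p.1) :=
        indicator_nonneg (fun r hr => Real.rpow_nonneg hr.1.le _) _
      simp only [norm_zero, ne_eq, OfNat.ofNat_ne_zero, not_false_eq_true, zero_pow, smul_zero]
      positivity

end Integrability


/-! ### Truncation of the ansatz -/

/-- The function `χ(r/δ) (a(r) + b F(r))` on the half-cylinder `r = σ x > 0`, extended by zero;
the cutoff `χ(r/δ)` is `1` for `r ≤ δ` and `0` for `r ≥ 2δ`. -/
def truncated (σ δ : ℝ) (a F : ℝ → ℝ) (b : Cylinder → ℝ) : Cylinder → ℂ :=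
  (half σ).indicator fun p =>
    ((Real.smoothTransition (2 - σ * p.1 / δ) * ansatz σ a F b p : ℝ) : ℂ)

section Truncated

variable {σ δ : ℝ} {a a₁ a₂ F F₁ F₂ : ℝ → ℝ} {b : Cylinder → ℝ} {s : Side}

theorem star_truncated : star (truncated σ δ a F b) = truncated σ δ a F b := by
  funext p
  by_cases hp : p ∈ half σ
  · simp [truncated, hp]
  · simp [truncated, hp]

theorem truncated_eq_zero (hδ : 0 < δ) {p : Cylinder} (hp : ¬ (0 < σ * p.1 ∧ σ * p.1 ≤ 2 * δ)) :
    truncated σ δ a F b p = 0 := by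
  by_cases h : p ∈ half σ
  · have h2 : 2 * δ < σ * p.1 := not_le.mp fun h' => hp ⟨h, h'⟩
    have h3 : 2 - σ * p.1 / δ ≤ 0 := by
      rw [sub_nonpos, le_div_iff₀ hδ]
      exact h2.le
    simp [truncated, Real.smoothTransition.zero_of_nonpos h3]
  · simp [truncated, h]

theorem truncated_eq_ansatz (hδ : 0 < δ) {p : Cylinder} (hp : 0 < σ * p.1) (hp' : σ * p.1 ≤ δ) :
    truncated σ δ a F b p = ansatz σ a F b p := by
  have h3 : 1 ≤ 2 - σ * p.1 / δ := by
    have := (div_le_one hδ).mpr hp'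
    linarith
  have hp2 : p ∈ half σ := hp
  simp [truncated, Real.smoothTransition.one_of_one_le h3, hp2]

theorem norm_truncated_le (p : Cylinder) : ‖truncated σ δ a F b p‖ ≤ |ansatz σ a F b p| := by
  by_cases h : p ∈ half σ
  · simp only [truncated, h, indicator_of_mem, Complex.norm_real, Real.norm_eq_abs, abs_mul,
      abs_of_nonneg (Real.smoothTransition.nonneg _)]
    exact mul_le_of_le_one_left (abs_nonneg _) (Real.smoothTransition.le_one _)
  · simp [truncated, h]

/-- The region avoids $x=0$, so it is covered by the two open half-cylinders, and on the opposite
one the function is zero. Nothing is claimed at the circle. -/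
theorem smoothOn_truncated (ha : IsRadial a a₁ a₂) (hF : IsRadial F F₁ F₂)
    (hb : SmoothOn univ b) (hσ : σ * σ = 1) : SmoothOn s.region (truncated σ δ a F b) := by
  have hσ0 : σ ≠ 0 := fun h => by simp [h] at hσ
  have hcut : SmoothOn (half σ) fun p : Cylinder => Real.smoothTransition (2 - σ * p.1 / δ) := by
    have h1 : ContDiff ℝ ∞ fun x : ℝ => Real.smoothTransition (2 - σ * x / δ) :=
      Real.smoothTransition.contDiff.comp
        (contDiff_const.sub ((contDiff_const.mul contDiff_id).div_const δ))
    exact SmoothOn.comp_fst (a := fun x : ℝ => Real.smoothTransition (2 - σ * x / δ))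
      h1.contDiffOn fun p _ => mem_univ _
  have h1 : SmoothOn (half σ) (truncated σ δ a F b) :=
    (hcut.mul (smoothOn_ansatz ha hF hb)).ofReal.congr fun p hp => by simp [truncated, hp]
  have h2 : SmoothOn (half (-σ)) (truncated σ δ a F b) :=
    (SmoothOn.const (0 : ℂ)).congr fun p hp => by
      have hp' : 0 < -σ * p.1 := hp
      have : p ∉ half σ := fun h => by
        have : 0 < σ * p.1 := h
        linarith
      simp [truncated, this]
  refine (h1.union (isOpen_half _) (isOpen_half _) h2).mono fun p hp => ?_
  have hne : σ * p.1 ≠ 0 := mul_ne_zero hσ0 (Side.ne_zero hp)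
  rcases lt_or_gt_of_ne hne with h | h
  · exact Or.inr (show 0 < -σ * p.1 by linarith)
  · exact Or.inl h

/-- The closure is taken in the whole cylinder and may meet the circle $x=0$, hence the weak
inequality; intersecting with the region makes it strict. -/
theorem tsupport_truncated (hδ : 0 < δ) :
    tsupport (truncated σ δ a F b) ⊆ {p | 0 ≤ σ * p.1 ∧ σ * p.1 ≤ 2 * δ} := by
  refine closure_minimal (fun p hp => ?_) ?_
  · by_contra h
    refine hp (truncated_eq_zero hδ fun h' => h ⟨h'.1.le, h'.2⟩)
  · exact (isClosed_le continuous_const (continuous_const.mul continuous_fst)).inter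
      (isClosed_le (continuous_const.mul continuous_fst) continuous_const)

theorem isCompact_annulus (hσ : σ * σ = 1) (r₁ r₂ : ℝ) :
    IsCompact {p : Cylinder | r₁ ≤ σ * p.1 ∧ σ * p.1 ≤ r₂} := by
  have hσ0 : σ ≠ 0 := fun h => by simp [h] at hσ
  have h1 : IsCompact ((fun x : ℝ => σ * x) ⁻¹' Icc r₁ r₂) :=
    (Homeomorph.mulLeft₀ σ hσ0).isCompact_preimage.mpr isCompact_Icc
  convert! h1.prod (isCompact_univ (X := AddCircle (2 * Real.pi))) using 1
  ext p
  simp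

variable {φ : Cylinder → ℝ} (hφ : SmoothOn univ φ)

theorem memLp_truncated (hσ : σ * σ = 1) (hσs : half σ ⊆ s.region) (hδ : 0 < δ)
    (hδ1 : 2 * δ ≤ 1) (ha : IsRadial a a₁ a₂) (hF : IsRadial F F₁ F₂) (hb : SmoothOn univ b)
    {κ C : ℝ} (hκ : 0 < κ) (haC : ∀ r, 0 < r → r ≤ 1 → |a r| ≤ C * r ^ κ)
    (hFC : ∀ r, 0 < r → r ≤ 1 → |F r| ≤ C * r ^ κ) :
    MemLp (truncated σ δ a F b) 2 (metric φ hφ s).vol := by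
  obtain ⟨B, hB0, hB⟩ := exists_bound_of_smoothOn hb
  have habs : |σ| = 1 := by
    have : |σ| * |σ| = 1 := by rw [← abs_mul, hσ, abs_one]
    nlinarith [abs_nonneg σ]
  refine memLp_of_radial_bound (C := C + B * C) hφ hσ hδ hδ1 hκ (smoothOn_truncated ha hF hb hσ) hσs
    (fun p _ hp => truncated_eq_zero hδ hp) fun p hp hp' => (norm_truncated_le p).trans ?_
  have hp1 : σ * p.1 ≤ 1 := by linarith
  have hx : |p.1| ≤ 1 := by
    have : |σ * p.1| ≤ 1 := abs_le.mpr ⟨by linarith, hp1⟩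
    rwa [abs_mul, habs, one_mul] at this
  calc |ansatz σ a F b p| ≤ |a (σ * p.1)| + |b p| * |F (σ * p.1)| := by
        rw [← abs_mul]
        exact abs_add_le _ _
    _ ≤ C * (σ * p.1) ^ κ + B * (C * (σ * p.1) ^ κ) := by
        have h1 := haC _ hp hp1
        have h2 := hFC _ hp hp1
        have h3 := hB p hx
        gcongr
    _ = (C + B * C) * (σ * p.1) ^ κ := by ring

/-- The image of a truncated ansatz under `-Δ + cK` is square integrable as soon as the leading
terms are. -/
theorem memLp_expr_truncated (hσ : σ * σ = 1) (hσs : half σ ⊆ s.region) (hδ : 0 < δ)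
    (hδ1 : 2 * δ ≤ 1) (ha : IsRadial a a₁ a₂) (hF : IsRadial F F₁ F₂) (hb : SmoothOn univ b)
    (hb0 : ∀ x x' y, b (x, y) = b (x', y)) (c : ℝ)
    {κ C : ℝ} (hκ : 0 < κ) (haC : ∀ r, 0 < r → r ≤ 1 → |a r| ≤ C * r ^ κ)
    (hFC : ∀ r, 0 < r → r ≤ 1 → |F r| ≤ C * r ^ κ)
    (hFC' : ∀ r, 0 < r → r ≤ 1 → |F₁ r - 2 * c * F r / r| ≤ C * r ^ κ)
    (hlead : ∀ p : Cylinder, 0 < σ * p.1 → σ * p.1 ≤ 1 →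
      |(-a₂ (σ * p.1) + a₁ (σ * p.1) / (σ * p.1) - 2 * c * a (σ * p.1) / (σ * p.1) ^ 2)
        + b p * (-F₂ (σ * p.1) + F₁ (σ * p.1) / (σ * p.1) - 2 * c * F (σ * p.1) / (σ * p.1) ^ 2)
        + σ * pd 0 φ p * (a₁ (σ * p.1) - 2 * c * a (σ * p.1) / (σ * p.1))| ≤ C * (σ * p.1) ^ κ) :
    MemLp ((metric φ hφ s).curvatureLaplacianExpr c (truncated σ δ a F b)) 2
      (metric φ hφ s).vol := by
  have habs : |σ| = 1 := by
    have : |σ| * |σ| = 1 := by rw [← abs_mul, hσ, abs_one]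
    nlinarith [abs_nonneg σ]
  have hsm := smoothOn_truncated (s := s) (δ := δ) ha hF hb hσ
  have hφ0 := hφ.pd isOpen_univ 0
  obtain ⟨B₁, hB₁0, hB₁⟩ := exists_bound_of_smoothOn
    (((SmoothOn.const σ).mul hφ0).mul hb)
  obtain ⟨B₂, hB₂0, hB₂⟩ := exists_bound_of_smoothOn
    ((SmoothOn.const c).mul ((hφ0.pd isOpen_univ 0).sub (hφ0.mul hφ0)))
  obtain ⟨B₃, hB₃0, hB₃⟩ := exists_bound_of_smoothOn hb
  obtain ⟨B₄, hB₄0, hB₄⟩ := exists_bound_of_smoothOn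
    (f := fun p => p.1 ^ 2 * Real.exp (2 * φ p) * (pd 1 (pd 1 b) p + pd 1 φ p * pd 1 b p))
    (((ContDiff.pow contDiff_fst 2).contDiffOn.mul
      (ContDiffOn.exp ((SmoothOn.const (2 : ℝ)).mul hφ))).mul
      (((hb.pd isOpen_univ 1).pd isOpen_univ 1).add ((hφ.pd isOpen_univ 1).mul
        (hb.pd isOpen_univ 1))))
  refine memLp_of_radial_bound (C := C + (B₁ * C + B₂ * (C + B₃ * C) + B₄ * C)) hφ hσ hδ hδ1 hκ
    ((metric φ hφ s).smoothOn_expr s.isOpen_region c hsm) hσs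
    (fun p hps hp => (metric φ hφ s).expr_eq_zero c fun h => hp ?_) fun p hp hp' => ?_
  · have h1 := tsupport_truncated hδ h
    have hσ0 : σ ≠ 0 := fun h => by simp [h] at hσ
    exact ⟨h1.1.lt_of_ne (mul_ne_zero hσ0 (Side.ne_zero hps)).symm, h1.2⟩
  have hN : IsOpen {p : Cylinder | 0 < σ * p.1 ∧ σ * p.1 < δ} :=
    (isOpen_half σ).inter (isOpen_lt (continuous_const.mul continuous_fst) continuous_const)
  rw [expr_ansatz hφ hσ ha hF hb hb0 c hsm hN (fun q hq => hq.1) (fun q hq => hσs hq.1)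
    (fun q hq => truncated_eq_ansatz hδ hq.1 hq.2.le) ⟨hp, hp'⟩, Complex.norm_real,
    Real.norm_eq_abs]
  have hp1 : σ * p.1 ≤ 1 := by linarith
  have hx : |p.1| ≤ 1 := by
    have : |σ * p.1| ≤ 1 := abs_le.mpr ⟨by linarith, hp1⟩
    rwa [abs_mul, habs, one_mul] at this
  have hpos : 0 < (σ * p.1) ^ κ := Real.rpow_pos_of_pos hp κ
  -- Of the terms in `expr_ansatz`, only the leading group needs the hypothesis `hlead`. The others
  -- are bounded coefficients times $F_1-2cF/r$, $a+bF$ or $F$, each $O(r^\kappa)$.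
  refine (abs_add_le _ _).trans ?_
  rw [add_mul]
  refine add_le_add (hlead p hp hp1) ?_
  refine (abs_sub _ _).trans ?_
  rw [add_mul]
  refine add_le_add ((abs_add_le _ _).trans ?_) ?_
  · rw [add_mul]
    refine add_le_add ?_ ?_
    · rw [abs_mul, mul_assoc B₁]
      exact mul_le_mul (hB₁ p hx) (hFC' _ hp hp1) (abs_nonneg _) hB₁0
    · rw [abs_mul, mul_assoc B₂]
      refine mul_le_mul ?_ ?_ (abs_nonneg _) hB₂0
      · have := hB₂ p hx
        rwa [← pow_two] at this
      · refine (abs_add_le _ _).trans ?_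
        rw [add_mul, mul_assoc, abs_mul]
        exact add_le_add (haC _ hp hp1)
          (mul_le_mul (hB₃ p hx) (hFC _ hp hp1) (abs_nonneg _) hB₃0)
  · rw [abs_mul, mul_assoc B₄]
    exact mul_le_mul (hB₄ p hx) (hFC _ hp hp1) (abs_nonneg _) hB₄0

end Truncated

/-! ### Cutoffs away from the singular circle -/

/-- The cutoff functions `θ(n² x² - 1)`, where `θ` is a smooth step. -/
def radialCutoff (n : ℕ) (r : ℝ) : ℝ := Real.smoothTransition (((n : ℝ) + 1) ^ 2 * r ^ 2 - 1)

theorem contDiff_radialCutoff (n : ℕ) : ContDiff ℝ ∞ (radialCutoff n) :=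
  Real.smoothTransition.contDiff.comp
    ((contDiff_const.mul (contDiff_id.pow 2)).sub contDiff_const)

theorem radialCutoff_eq_zero {n : ℕ} {r : ℝ} (h : |r| ≤ ((n : ℝ) + 1)⁻¹) : radialCutoff n r = 0 := by
  refine Real.smoothTransition.zero_of_nonpos ?_
  have hn : (0 : ℝ) < (n : ℝ) + 1 := by positivity
  have h1 : |r| ^ 2 ≤ (((n : ℝ) + 1)⁻¹) ^ 2 := by gcongr
  rw [sq_abs, inv_pow] at h1
  have h2 : ((n : ℝ) + 1) ^ 2 * r ^ 2 ≤ ((n : ℝ) + 1) ^ 2 * (((n : ℝ) + 1) ^ 2)⁻¹ := by gcongr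
  rw [mul_inv_cancel₀ (by positivity)] at h2
  linarith

theorem radialCutoff_eq_one {n : ℕ} {r : ℝ} (h : 2 ≤ ((n : ℝ) + 1) ^ 2 * r ^ 2) :
    radialCutoff n r = 1 := Real.smoothTransition.one_of_one_le (by linarith)

theorem abs_radialCutoff_le (n : ℕ) (r : ℝ) : |radialCutoff n r| ≤ 1 := by
  rw [radialCutoff, abs_of_nonneg (Real.smoothTransition.nonneg _)]
  exact Real.smoothTransition.le_one _

theorem eventually_two_lt {r : ℝ} (hr : r ≠ 0) :
    ∀ᶠ n : ℕ in atTop, 2 < ((n : ℝ) + 1) ^ 2 * r ^ 2 := by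
  have h2 : 0 < r ^ 2 := by positivity
  have h : Tendsto (fun n : ℕ => (n : ℝ) * r ^ 2) atTop atTop :=
    tendsto_natCast_atTop_atTop.atTop_mul_const h2
  filter_upwards [h.eventually_gt_atTop 2] with n hn
  have : (n : ℝ) ≤ ((n : ℝ) + 1) ^ 2 := by nlinarith [(Nat.cast_nonneg n : (0 : ℝ) ≤ n)]
  nlinarith

theorem deriv_radialCutoff_nonneg (n : ℕ) {r : ℝ} (hr : 0 < r) : 0 ≤ deriv (radialCutoff n) r := by
  have h1 : HasDerivAt (fun r : ℝ => ((n : ℝ) + 1) ^ 2 * r ^ 2 - 1)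
      (((n : ℝ) + 1) ^ 2 * (2 * r)) r := by
    simpa using (((hasDerivAt_id r).pow 2).const_mul (((n : ℝ) + 1) ^ 2)).sub_const 1
  have h2 : DifferentiableAt ℝ Real.smoothTransition (((n : ℝ) + 1) ^ 2 * r ^ 2 - 1) :=
    (Real.smoothTransition.contDiffAt (n := 1)).differentiableAt one_ne_zero
  have h3 := (h2.hasDerivAt.comp r h1).deriv
  change deriv (radialCutoff n) r = _ at h3
  rw [h3]
  exact mul_nonneg Real.smoothTransition.monotone.deriv_nonneg (by positivity)

theorem deriv_radialCutoff_eq_zero {n : ℕ} {r : ℝ} (h : 2 < ((n : ℝ) + 1) ^ 2 * r ^ 2) :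
    deriv (radialCutoff n) r = 0 := by
  have h1 : radialCutoff n =ᶠ[𝓝 r] fun _ => 1 := by
    have : IsOpen {r : ℝ | 2 < ((n : ℝ) + 1) ^ 2 * r ^ 2} :=
      isOpen_lt continuous_const (by fun_prop)
    filter_upwards [this.mem_nhds h] with r' hr' using radialCutoff_eq_one (le_of_lt hr')
  rw [h1.deriv_eq, deriv_const]

theorem integrableOn_deriv_radialCutoff (n : ℕ) (δ : ℝ) :
    IntegrableOn (deriv (radialCutoff n)) (Ioc 0 δ) :=
  (((contDiff_radialCutoff n).continuous_deriv (by simp)).integrableOn_Icc).mono_set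
    Ioc_subset_Icc_self

theorem integrable_deriv_radialCutoff {σ : ℝ} (hσ : σ * σ = 1) (n : ℕ) (δ : ℝ) :
    Integrable (fun p : Cylinder => (Ioc 0 δ).indicator (deriv (radialCutoff n)) (σ * p.1)) := by
  have hσ0 : σ ≠ 0 := fun h => by simp [h] at hσ
  have h1 : Integrable ((Ioc 0 δ).indicator (deriv (radialCutoff n))) :=
    (integrable_indicator_iff measurableSet_Ioc).mpr (integrableOn_deriv_radialCutoff n δ)
  have h3 := (h1.comp_mul_left' hσ0).mul_prod (ν := (volume : Measure (AddCircle (2 * Real.pi))))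
    (integrable_const (1 : ℝ))
  simpa [Measure.volume_eq_prod] using h3

/-- The cutoff rises from 0 to 1 on $(0,\delta]$, so its derivative has mass 1 there, and the circle
has length $2\pi$. With nonnegativity this makes the derivatives averaging weights on collars that
shrink to the circle. -/
theorem integral_deriv_radialCutoff {σ : ℝ} (hσ : σ * σ = 1) {n : ℕ} {δ : ℝ} (hδ : 0 < δ)
    (h : 2 ≤ ((n : ℝ) + 1) ^ 2 * δ ^ 2) :
    ∫ p : Cylinder, (Ioc 0 δ).indicator (deriv (radialCutoff n)) (σ * p.1) = 2 * Real.pi := by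
  have habs : |σ| = 1 := by
    have : |σ| * |σ| = 1 := by rw [← abs_mul, hσ, abs_one]
    nlinarith [abs_nonneg σ]
  have h0 : radialCutoff n 0 = 0 := radialCutoff_eq_zero (by simp; positivity)
  have h1 : ∫ r, (Ioc 0 δ).indicator (deriv (radialCutoff n)) r = 1 := by
    rw [integral_indicator measurableSet_Ioc, ← intervalIntegral.integral_of_le hδ.le,
      intervalIntegral.integral_deriv_eq_sub'
        (radialCutoff n) rfl (fun r _ => ((contDiff_radialCutoff n).differentiable (by simp)) r)
        ((contDiff_radialCutoff n).continuous_deriv (by simp)).continuousOn,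
      radialCutoff_eq_one h, h0, sub_zero]
  have h2 := integral_prod_mul (μ := (volume : Measure ℝ))
    (ν := (volume : Measure (AddCircle (2 * Real.pi))))
    (fun x : ℝ => (Ioc 0 δ).indicator (deriv (radialCutoff n)) (σ * x)) (fun _ => (1 : ℝ))
  rw [Measure.integral_comp_mul_left, h1, abs_inv, habs] at h2
  rw [Measure.volume_eq_prod]
  simp only [mul_one, integral_const, smul_eq_mul] at h2
  rw [h2]
  simp [Measure.real, Real.pi_pos.le]


theorem sign_mul_fst_ne_zero {s : Side} {σ : ℝ} {p : Cylinder} (hσ : σ * σ = 1) (hp : p ∈ s.region) :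
    σ * p.1 ≠ 0 := by
  have hσ0 : σ ≠ 0 := fun h => by simp [h] at hσ
  exact mul_ne_zero hσ0 (Side.ne_zero hp)

theorem abs_eq_mul {σ x : ℝ} (hσ : σ * σ = 1) (hx : 0 < σ * x) : |x| = σ * x := by
  have habs : |σ| = 1 := by
    have : |σ| * |σ| = 1 := by rw [← abs_mul, hσ, abs_one]
    nlinarith [abs_nonneg σ]
  rw [← abs_of_pos hx, abs_mul, habs, one_mul]

theorem smoothOn_radialCutoff (Ω : Set Cylinder) (n : ℕ) :
    SmoothOn Ω (fun p => radialCutoff n p.1) :=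
  SmoothOn.comp_fst (contDiff_radialCutoff n).contDiffOn fun _ _ => mem_univ _

theorem pd_radialCutoff {σ : ℝ} (hσ : σ * σ = 1) (n : ℕ) (p : Cylinder) :
    pd 0 (fun p : Cylinder => radialCutoff n p.1) p = σ * deriv (radialCutoff n) (σ * p.1) := by
  have e : ∀ x, radialCutoff n x = radialCutoff n (σ * x) := fun x => by
    rw [radialCutoff, radialCutoff, mul_pow, pow_two σ, hσ, one_mul]
  apply pd_zero_eq
  have h1 : HasDerivAt (fun x : ℝ => σ * x) σ p.1 := by
    simpa using (hasDerivAt_id p.1).const_mul σ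
  have h2 := (((contDiff_radialCutoff n).differentiable (by simp)) (σ * p.1)).hasDerivAt.comp p.1 h1
  exact (h2.congr_of_eventuallyEq (Eventually.of_forall fun x => e x)).congr_deriv (mul_comm _ _)

/-! ### The boundary pairing as a limit of Wronskians -/

section Pairing

variable {φ : Cylinder → ℝ} (hφ : SmoothOn univ φ) {s : Side} {σ δ : ℝ}
  {a a₁ a₂ a' a₁' a₂' F F₁ F₂ : ℝ → ℝ} {b b' : Cylinder → ℝ}

/-- Provides the compact set for `green_cutoff`: the cutoff bounds $r$ from below and the truncation
bounds it from above. -/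
theorem smul_truncated_eq_zero (hσ : σ * σ = 1) (n : ℕ) {p : Cylinder}
    (hp : p ∉ {p : Cylinder | ((n : ℝ) + 1)⁻¹ ≤ σ * p.1 ∧ σ * p.1 ≤ 2 * δ}) (hδ : 0 < δ) :
    radialCutoff n p.1 = 0 ∨ p ∉ tsupport (truncated σ δ a F b) := by
  by_contra! hcon
  obtain ⟨h1, h2⟩ := hcon
  have h3 := tsupport_truncated hδ h2
  refine hp ⟨?_, h3.2⟩
  by_contra! h4
  apply h1
  apply radialCutoff_eq_zero
  rcases h3.1.eq_or_lt with h5 | h5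
  · have hσ0 : σ ≠ 0 := fun h => by simp [h] at hσ
    have : p.1 = 0 := (mul_eq_zero.mp h5.symm).resolve_left hσ0
    rw [this, abs_zero]
    positivity
  · rw [abs_eq_mul hσ h5]
    exact h4.le

theorem smul_truncated_mem (hσ : σ * σ = 1) (hσs : half σ ⊆ s.region) (hδ : 0 < δ)
    (ha : IsRadial a a₁ a₂) (hF : IsRadial F F₁ F₂) (hb : SmoothOn univ b) (n : ℕ) :
    (fun p => radialCutoff n p.1 • truncated σ δ a F b p) ∈ testFunctions s.region := by
  have hS := isCompact_annulus hσ ((n : ℝ) + 1)⁻¹ (2 * δ)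
  have hSs : {p : Cylinder | ((n : ℝ) + 1)⁻¹ ≤ σ * p.1 ∧ σ * p.1 ≤ 2 * δ} ⊆ s.region :=
    fun p hp => hσs (show 0 < σ * p.1 from lt_of_lt_of_le (by positivity) hp.1)
  have h0 : ∀ p ∉ {p : Cylinder | ((n : ℝ) + 1)⁻¹ ≤ σ * p.1 ∧ σ * p.1 ≤ 2 * δ},
      radialCutoff n p.1 • truncated σ δ a F b p = 0 := fun p hp => by
    rcases smul_truncated_eq_zero (a := a) (F := F) (b := b) hσ n hp hδ with h | h
    · rw [h, zero_smul]
    · rw [image_eq_zero_of_notMem_tsupport h, smul_zero]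
  refine ⟨SmoothOn.of_eq_zero s.isOpen_region hS.isClosed hSs
    ((smoothOn_radialCutoff _ n).smul (smoothOn_truncated ha hF hb hσ)) h0,
    HasCompactSupport.intro hS h0, ?_⟩
  exact (closure_minimal (Function.support_subset_iff'.mpr h0) hS.isClosed).trans hSs

/-- The flux of two truncated functions is given by the Wronskian of the radial parts. -/
theorem flux_truncated (hσ : σ * σ = 1) (hσs : half σ ⊆ s.region) (hδ : 0 < δ)
    (ha : IsRadial a a₁ a₂) (ha' : IsRadial a' a₁' a₂') (hF : IsRadial F F₁ F₂)
    (hb0 : ∀ x x' y, b (x, y) = b (x', y)) (hb0' : ∀ x x' y, b' (x, y) = b' (x', y))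
    {p : Cylinder} (hp : 0 < σ * p.1) (hp' : σ * p.1 < δ) :
    (metric φ hφ s).flux (truncated σ δ a F b) (truncated σ δ a' F b') 0 p =
      ((σ * ((σ * p.1)⁻¹ * Real.exp (-φ p) * (ansatz σ a₁ F₁ b p * ansatz σ a' F b' p
        - ansatz σ a F b p * ansatz σ a₁' F₁ b' p)) : ℝ) : ℂ) := by
  have hN : IsOpen {p : Cylinder | 0 < σ * p.1 ∧ σ * p.1 < δ} :=
    (isOpen_half σ).inter (isOpen_lt (continuous_const.mul continuous_fst) continuous_const)
  have hpd : ∀ {f f₁ f₂ : ℝ → ℝ} {β : Cylinder → ℝ}, IsRadial f f₁ f₂ →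
      (∀ x x' y, β (x, y) = β (x', y)) →
      pd 0 (truncated σ δ f F β) p = ((σ * ansatz σ f₁ F₁ β p : ℝ) : ℂ) := by
    intro f f₁ f₂ β hf hβ
    have e : truncated σ δ f F β =ᶠ[𝓝 p] fun q => (ansatz σ f F β q : ℂ) := by
      filter_upwards [hN.mem_nhds ⟨hp, hp'⟩] with q hq using truncated_eq_ansatz hδ hq.1 hq.2.le
    rw [pd_congr 0 e, pd_zero_ofReal (hasDerivAt_ansatz hβ hf.hasDerivAt hF.hasDerivAt hp)]
  rw [RiemannianMetric.flux, grad_zero hφ _ (hσs hp), grad_zero hφ _ (hσs hp), hpd ha hb0,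
    hpd ha' hb0', truncated_eq_ansatz hδ hp hp'.le, truncated_eq_ansatz hδ hp hp'.le,
    volDensity_eq, abs_eq_mul hσ hp, Complex.real_smul]
  push_cast
  ring

/-- If the Wronskian of two truncated functions is bounded below near the singular circle, then
their boundary pairing does not vanish. -/
theorem pairing_ne_zero (hσ : σ * σ = 1) (hσs : half σ ⊆ s.region) (hδ : 0 < δ)
    (ha : IsRadial a a₁ a₂) (ha' : IsRadial a' a₁' a₂') (hF : IsRadial F F₁ F₂)
    (hb : SmoothOn univ b) (hb' : SmoothOn univ b')
    (hb0 : ∀ x x' y, b (x, y) = b (x', y)) (hb0' : ∀ x x' y, b' (x, y) = b' (x', y)) (c : ℝ)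
    (h1 : MemLp (truncated σ δ a F b) 2 (metric φ hφ s).vol)
    (h2 : MemLp (truncated σ δ a' F b') 2 (metric φ hφ s).vol)
    (h3 : MemLp ((metric φ hφ s).curvatureLaplacianExpr c (truncated σ δ a F b)) 2
      (metric φ hφ s).vol)
    (h4 : MemLp ((metric φ hφ s).curvatureLaplacianExpr c (truncated σ δ a' F b')) 2
      (metric φ hφ s).vol)
    {W : Cylinder → ℝ} (hW : Continuous W) {m B : ℝ} (hm : 0 < m)
    (hWm : ∀ p : Cylinder, 0 < σ * p.1 → σ * p.1 ≤ δ → m ≤ W p)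
    (hWB : ∀ p : Cylinder, 0 < σ * p.1 → σ * p.1 ≤ δ → W p ≤ B)
    (hwr : ∀ p : Cylinder, 0 < σ * p.1 → σ * p.1 < δ →
      (σ * p.1)⁻¹ * Real.exp (-φ p) * (ansatz σ a₁ F₁ b p * ansatz σ a' F b' p
        - ansatz σ a F b p * ansatz σ a₁' F₁ b' p) = W p) :
    ∫ p, ((metric φ hφ s).curvatureLaplacianExpr c (truncated σ δ a F b) p
        * truncated σ δ a' F b' p
      - truncated σ δ a F b p
        * (metric φ hφ s).curvatureLaplacianExpr c (truncated σ δ a' F b') p)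
      ∂(metric φ hφ s).vol ≠ 0 := by
  have hΩ := s.isOpen_region
  set g := metric φ hφ s with hg
  set h := truncated σ δ a F b with hh
  set k := truncated σ δ a' F b' with hk
  set P : Cylinder → ℂ := fun p => g.curvatureLaplacianExpr c h p * k p
      - h p * g.curvatureLaplacianExpr c k p with hP
  have hsm : SmoothOn s.region h := smoothOn_truncated ha hF hb hσ
  have hsm' : SmoothOn s.region k := smoothOn_truncated ha' hF hb' hσ
  have hPi : Integrable P g.vol := (h3.integrable_mul h2).sub (h1.integrable_mul h4)
  have hlim : Tendsto (fun n : ℕ => ∫ p, radialCutoff n p.1 • P p ∂g.vol) atTop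
      (𝓝 (∫ p, P p ∂g.vol)) := by
    refine tendsto_integral_of_dominated_convergence (fun p => ‖P p‖) (fun n => ?_) hPi.norm
      (fun n => Eventually.of_forall fun p => ?_) ?_
    · exact ((contDiff_radialCutoff n).continuous.comp continuous_fst).aestronglyMeasurable.smul
        hPi.1
    · rw [norm_smul]
      exact mul_le_of_le_one_left (norm_nonneg _) (abs_radialCutoff_le n _)
    · filter_upwards [g.ae_mem hΩ] with p hp
      refine tendsto_const_nhds.congr' ?_
      filter_upwards [eventually_two_lt (Side.ne_zero hp)] with n hn
      rw [radialCutoff_eq_one hn.le, one_smul]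
  set Φ : ℕ → Cylinder → ℝ := fun n p =>
    (Ioc 0 δ).indicator (deriv (radialCutoff n)) (σ * p.1) with hΦ
  have hΦ0 : ∀ n p, 0 ≤ Φ n p := fun n p =>
    indicator_nonneg (fun r hr => deriv_radialCutoff_nonneg n hr.1) _
  -- The cutoff depends on $x$ alone, so only the $x$-component of the flux survives; the condition
  -- on `n` places the support of its derivative within $r<\delta$, where the truncation is not
  -- active.
  have hcut : ∀ n : ℕ, 2 < ((n : ℝ) + 1) ^ 2 * δ ^ 2 →
      ∫ p, radialCutoff n p.1 • P p ∂g.vol = ((∫ p, Φ n p * W p : ℝ) : ℂ) := by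
    intro n hn
    have hgr := g.green_cutoff hΩ c hsm hsm' (smoothOn_radialCutoff s.region n)
      (isCompact_annulus hσ ((n : ℝ) + 1)⁻¹ (2 * δ))
      (fun p hp => hσs (show 0 < σ * p.1 from lt_of_lt_of_le (by positivity) hp.1))
      (fun p hp => smul_truncated_eq_zero hσ n hp hδ)
    refine hgr.trans ?_
    have hset : ∫ p in s.region, ((Φ n p * W p : ℝ) : ℂ) = ∫ p, ((Φ n p * W p : ℝ) : ℂ) := by
      refine setIntegral_eq_integral_of_forall_compl_eq_zero fun p hp => ?_
      have hm : σ * p.1 ∉ Ioc 0 δ := fun h => hp (hσs h.1)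
      simp only [hΦ, indicator_of_notMem hm, zero_mul, Complex.ofReal_zero]
    rw [← integral_complex_ofReal, ← hset]
    refine setIntegral_congr_fun hΩ.measurableSet fun p hp => ?_
    have hpd1 : pd 1 (fun p : Cylinder => radialCutoff n p.1) p = 0 := by simp [pd]
    simp only [Fin.sum_univ_two, hpd1, zero_smul, add_zero, pd_radialCutoff hσ]
    by_cases hp0 : 0 < σ * p.1
    · rcases lt_or_ge (σ * p.1) δ with hlt | hge
      · rw [flux_truncated hφ hσ hσs hδ ha ha' hF hb0 hb0' hp0 hlt, hwr p hp0 hlt, hΦ]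
        simp only
        rw [indicator_of_mem (show σ * p.1 ∈ Ioc 0 δ from ⟨hp0, hlt.le⟩), Complex.real_smul]
        have hσc : (σ : ℂ) * σ = 1 := by exact_mod_cast hσ
        push_cast
        -- One $\sigma$ comes from $\partial_x$ of the cutoff and one from the flux.
        linear_combination (deriv (radialCutoff n) (σ * p.1) * W p : ℂ) * hσc
      · have hd : deriv (radialCutoff n) (σ * p.1) = 0 := by
          refine deriv_radialCutoff_eq_zero (hn.trans_le ?_)
          gcongr
        have hΦz : Φ n p = 0 := by
          by_cases hm : σ * p.1 ∈ Ioc 0 δ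
          · simp only [hΦ, indicator_of_mem hm, hd]
          · simp only [hΦ, indicator_of_notMem hm]
        rw [hd, hΦz]
        simp
    · have hΦz : Φ n p = 0 := by
        have hm : σ * p.1 ∉ Ioc 0 δ := fun h => hp0 h.1
        simp only [hΦ, indicator_of_notMem hm]
      have hts : p ∉ tsupport k := fun h => by
        have := (tsupport_truncated hδ h).1
        exact hp0 (this.lt_of_ne (sign_mul_fst_ne_zero hσ hp).symm)
      rw [g.flux_eq_zero h 0 hts, hΦz]
      simp
  have hlow : ∀ n : ℕ, 2 < ((n : ℝ) + 1) ^ 2 * δ ^ 2 → m * (2 * Real.pi) ≤ ∫ p, Φ n p * W p := by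
    intro n hn
    have hi : Integrable (Φ n) := integrable_deriv_radialCutoff hσ n δ
    have hle : ∀ p, m * Φ n p ≤ Φ n p * W p ∧ |Φ n p * W p| ≤ B * Φ n p := by
      intro p
      by_cases hm' : σ * p.1 ∈ Ioc 0 δ
      · have e1 := hWm p hm'.1 hm'.2
        have e2 := hWB p hm'.1 hm'.2
        have e3 := hΦ0 n p
        rw [abs_of_nonneg (mul_nonneg e3 (hm.le.trans e1))]
        constructor <;> nlinarith
      · have : Φ n p = 0 := by simp only [hΦ, indicator_of_notMem hm']
        simp [this]
    calc m * (2 * Real.pi) = m * ∫ p, Φ n p :=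
          congrArg (m * ·) (integral_deriv_radialCutoff hσ hδ hn.le).symm
      _ = ∫ p, m * Φ n p := (integral_const_mul _ _).symm
      _ ≤ ∫ p, Φ n p * W p := integral_mono (hi.const_mul m) ?_ fun p => (hle p).1
    exact Integrable.mono' (hi.const_mul B) (hi.1.mul hW.aestronglyMeasurable)
      (Eventually.of_forall fun p => (hle p).2)
  have hre : Tendsto (fun n : ℕ => (∫ p, radialCutoff n p.1 • P p ∂g.vol).re) atTop
      (𝓝 (∫ p, P p ∂g.vol).re) := (Complex.continuous_re.tendsto _).comp hlim
  -- The lower bound $2\pi m$ does not depend on `n` and so survives the limit; convergence of the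
  -- averages of $W$ is not needed.
  have hge : m * (2 * Real.pi) ≤ (∫ p, P p ∂g.vol).re := by
    refine ge_of_tendsto hre ?_
    filter_upwards [eventually_two_lt hδ.ne'] with n hn
    rw [hcut n hn, Complex.ofReal_re]
    exact hlow n hn
  intro hzero
  rw [hzero, Complex.zero_re] at hge
  have : 0 < m * (2 * Real.pi) := by positivity
  linarith

end Pairing


/-! ### The two independent functions $r^{1+\nu}$ and $r^{1-\nu}+bF$ -/

/-- The Euler operator `-∂² + r⁻¹ ∂ - (1 - ν²) r⁻²` on powers of `r`. -/
theorem euler_rpow (ν q : ℝ) {r : ℝ} (hr : 0 < r) :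
    -(q * ((q - 1) * r ^ (q - 1 - 1))) + q * r ^ (q - 1) / r - (1 - ν ^ 2) * r ^ q / r ^ 2
      = (ν ^ 2 - (q - 1) ^ 2) * (r ^ q / r ^ 2) := by
  rw [Real.rpow_sub hr (q - 1), Real.rpow_sub hr q, Real.rpow_one]
  field_simp
  ring

section Pair

variable {φ : Cylinder → ℝ} {s : Side} {σ : ℝ}

/-- The coefficient `σ ν (1 - ν) ∂ₓφ(0, y)` of the second order term. -/
def correctionCoeff (φ : Cylinder → ℝ) (σ ν : ℝ) (p : Cylinder) : ℝ :=
  σ * ν * (1 - ν) * pd 0 φ (0, p.2)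

theorem smoothOn_correctionCoeff (hφ : SmoothOn univ φ) (σ ν : ℝ) :
    SmoothOn univ (correctionCoeff φ σ ν) := by
  have h1 : ContDiffOn ℝ ∞ (pd 0 φ ∘ cover) univ := hφ.pd isOpen_univ 0
  have h2 : ContDiffOn ℝ ∞ (fun q : ℝ × ℝ => (pd 0 φ ∘ cover) (0, q.2)) univ :=
    h1.comp (contDiff_const.prodMk contDiff_snd).contDiffOn fun _ _ => mem_univ _
  exact (SmoothOn.const (σ * ν * (1 - ν))).mul h2

/-- Near the singular circle of a half-cylinder there are two smooth square integrable functions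
whose images under `-Δ + cK` are square integrable, which are independent modulo the domain of the
closure. -/
theorem exists_deficiency_pair (hφ : SmoothOn univ φ) (hσ : σ * σ = 1) (hσs : half σ ⊆ s.region)
    {c ν : ℝ} (hν0 : 0 < ν) (hν1 : ν < 1) (hc : 2 * c = 1 - ν ^ 2) {ε : ℝ} (hε : 0 < ε) :
    ∃ h : Fin 2 → Cylinder → ℂ, ∃ hL2 : ∀ i, MemLp (h i) 2 (metric φ hφ s).vol,
      (∀ i, SmoothOn s.region (h i)) ∧ (∀ i, star (h i) = h i) ∧
      (∀ i, MemLp ((metric φ hφ s).curvatureLaplacianExpr c (h i)) 2 (metric φ hφ s).vol) ∧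
      (∀ i, tsupport (h i) ⊆ {p | 0 ≤ σ * p.1 ∧ σ * p.1 < ε}) ∧
      LinearIndependent ℂ (fun i =>
        (operator φ hφ s c).closure.domain.mkQ ((hL2 i).toLp (h i))) := by
  obtain ⟨F, F₁, F₂, hF, hEF, hWF, C, hC0, hFC⟩ := exists_radialCorrection hν0 hν1
  -- One exponent for all estimates: $\kappa$ is at most each of $\nu$, $1-\nu$, $1+\nu$, and it is
  -- the exponent in the bound for $F_1$.
  set κ := ν * (1 - ν) with hκ
  have hκ0 : 0 < κ := mul_pos hν0 (by linarith)
  set b := correctionCoeff φ σ ν with hb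
  have hbs : SmoothOn univ b := smoothOn_correctionCoeff hφ σ ν
  obtain ⟨Bφ, hBφ0, hBφ⟩ := exists_bound_of_smoothOn hφ
  obtain ⟨B, hB0, hB⟩ := exists_bound_of_smoothOn hbs
  obtain ⟨B', hB'0, hB'⟩ := exists_bound_of_smoothOn (hφ.pd isOpen_univ 0)
  obtain ⟨L, hL0, hL⟩ := exists_lipschitz_of_smoothOn (hφ.pd isOpen_univ 0)
  -- The support has to lie in $r<\varepsilon$ and in the collar $r\le1$ where the bounds hold;
  -- $B\delta\le\nu$ gives $|br|\le\nu$, so that $2\nu+br\ge\nu$.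
  obtain ⟨δ, hδ, hδε, hδ1, hδB⟩ : ∃ δ : ℝ, 0 < δ ∧ 2 * δ < ε ∧ 2 * δ ≤ 1 ∧ B * δ ≤ ν := by
    refine ⟨min (ε / 4) (min (1 / 2) (ν / (B + 1))), by positivity, ?_, ?_, ?_⟩
    · linarith [min_le_left (ε / 4) (min (1 / 2) (ν / (B + 1)))]
    · linarith [min_le_right (ε / 4) (min (1 / 2) (ν / (B + 1))),
        min_le_left (1 / 2) (ν / (B + 1))]
    · have h1 : min (ε / 4) (min (1 / 2) (ν / (B + 1))) ≤ ν / (B + 1) :=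
        (min_le_right _ _).trans (min_le_right _ _)
      calc B * min (ε / 4) (min (1 / 2) (ν / (B + 1))) ≤ (B + 1) * (ν / (B + 1)) := by
            gcongr
            linarith
        _ = ν := by field_simp
  have habs : ∀ p : Cylinder, 0 < σ * p.1 → σ * p.1 ≤ 1 → |p.1| ≤ 1 := fun p h0 h1 => by
    rwa [abs_eq_mul hσ h0]
  have hσabs : |σ| = 1 := by
    have : |σ| * |σ| = 1 := by rw [← abs_mul, hσ, abs_one]
    nlinarith [abs_nonneg σ]
  let q : Fin 2 → ℝ := ![1 + ν, 1 - ν]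
  -- Only the exponent $1-\nu$ is corrected: for $1+\nu$ the first order error is $O(r^\nu)$,
  -- already square integrable.
  let β : Fin 2 → Cylinder → ℝ := ![fun _ => 0, b]
  have hβ : ∀ i, SmoothOn univ (β i) := fun i => by
    fin_cases i
    exacts [SmoothOn.const 0, hbs]
  have hβ0 : ∀ i, ∀ x x' y, β i (x, y) = β i (x', y) := fun i => by
    fin_cases i
    exacts [fun _ _ _ => rfl, fun _ _ _ => rfl]
  have ha : ∀ i, IsRadial (fun r => r ^ q i) (fun r => q i * r ^ (q i - 1))
    (fun r => q i * ((q i - 1) * r ^ (q i - 1 - 1))) := fun i => isRadial_rpow (q i)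
  set M := 1 + 2 * C + 2 * B' + L with hM
  have hpow : ∀ {r e : ℝ}, 0 < r → r ≤ 1 → κ ≤ e → r ^ e ≤ r ^ κ := fun hr hr1 he =>
    Real.rpow_le_rpow_of_exponent_ge hr hr1 he
  have hqκ : ∀ i, κ ≤ q i := fun i => by
    fin_cases i
    · change κ ≤ 1 + ν
      nlinarith
    · change κ ≤ 1 - ν
      nlinarith
  have haM : ∀ i, ∀ r : ℝ, 0 < r → r ≤ 1 → |r ^ q i| ≤ M * r ^ κ := fun i r hr hr1 => by
    rw [abs_of_pos (Real.rpow_pos_of_pos hr _)]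
    have := Real.rpow_pos_of_pos hr κ
    refine (hpow hr hr1 (hqκ i)).trans (le_mul_of_one_le_left this.le ?_)
    linarith
  have hFκ : ∀ r : ℝ, 0 < r → r ≤ 1 → |F r| ≤ C * (r * r ^ κ) := fun r hr hr1 => by
    have := (hFC r hr hr1).1
    rwa [Real.rpow_add hr, Real.rpow_one] at this
  have hFM : ∀ r : ℝ, 0 < r → r ≤ 1 → |F r| ≤ M * r ^ κ := fun r hr hr1 => by
    have hp := Real.rpow_pos_of_pos hr κ
    calc |F r| ≤ C * (r * r ^ κ) := hFκ r hr hr1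
      _ ≤ C * (1 * r ^ κ) := by gcongr
      _ ≤ M * r ^ κ := by
        rw [one_mul]
        gcongr
        linarith
  have hFM' : ∀ r : ℝ, 0 < r → r ≤ 1 → |F₁ r - 2 * c * F r / r| ≤ M * r ^ κ := fun r hr hr1 => by
    have hp := Real.rpow_pos_of_pos hr κ
    have h2c : |2 * c| ≤ 1 := by
      rw [hc, abs_of_nonneg (by nlinarith)]
      nlinarith
    have h3 : |2 * c * F r / r| ≤ C * r ^ κ := by
      rw [abs_div, abs_mul, abs_of_pos hr, div_le_iff₀ hr]
      calc |2 * c| * |F r| ≤ 1 * (C * (r * r ^ κ)) := by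
            have := hFκ r hr hr1
            gcongr
        _ = C * r ^ κ * r := by ring
    calc |F₁ r - 2 * c * F r / r| ≤ C * r ^ κ + C * r ^ κ :=
          (abs_sub _ _).trans (add_le_add (hFC r hr hr1).2 h3)
      _ = 2 * C * r ^ κ := by ring
      _ ≤ M * r ^ κ := by
        gcongr
        linarith
  have hL2 : ∀ i, MemLp (truncated σ δ (fun r => r ^ q i) F (β i)) 2 (metric φ hφ s).vol :=
    fun i => memLp_truncated hφ hσ hσs hδ hδ1 (ha i) hF (hβ i) hκ0 (haM i) hFM
  have hlead : ∀ i, ∀ r : ℝ, 0 < r → -(q i * ((q i - 1) * r ^ (q i - 1 - 1)))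
      + q i * r ^ (q i - 1) / r - 2 * c * r ^ q i / r ^ 2 = 0 := fun i r hr => by
    rw [hc, euler_rpow ν (q i) hr]
    have : ν ^ 2 - (q i - 1) ^ 2 = 0 := by
      fin_cases i
      · change ν ^ 2 - (1 + ν - 1) ^ 2 = 0
        ring
      · change ν ^ 2 - (1 - ν - 1) ^ 2 = 0
        ring
    rw [this, zero_mul]
  have hfirst : ∀ i, ∀ r : ℝ, 0 < r → q i * r ^ (q i - 1) - 2 * c * r ^ q i / r =
      (q i - (1 - ν ^ 2)) * r ^ (q i - 1) := fun i r hr => by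
    rw [hc, Real.rpow_sub hr, Real.rpow_one]
    ring
  have hE : ∀ i, MemLp ((metric φ hφ s).curvatureLaplacianExpr c
      (truncated σ δ (fun r => r ^ q i) F (β i))) 2 (metric φ hφ s).vol := fun i => by
    refine memLp_expr_truncated (C := M) hφ hσ hσs hδ hδ1 (ha i) hF (hβ i) (hβ0 i) c hκ0 (haM i)
      hFM hFM' fun p hp hp1 => ?_
    simp only [hlead i _ hp, hfirst i _ hp, zero_add]
    have hrκ := Real.rpow_pos_of_pos hp κ
    fin_cases i
    · change |0 * _ + σ * pd 0 φ p * ((1 + ν - (1 - ν ^ 2)) * (σ * p.1) ^ (1 + ν - 1))| ≤ _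
      rw [zero_mul, zero_add, show 1 + ν - 1 = ν by ring, abs_mul, abs_mul, hσabs, one_mul,
        abs_mul, abs_of_pos (Real.rpow_pos_of_pos hp ν),
        abs_of_nonneg (show 0 ≤ 1 + ν - (1 - ν ^ 2) by nlinarith)]
      have e1 := hB' p (habs p hp hp1)
      have e2 : (σ * p.1) ^ ν ≤ (σ * p.1) ^ κ := hpow hp hp1 (by nlinarith)
      calc |pd 0 φ p| * ((1 + ν - (1 - ν ^ 2)) * (σ * p.1) ^ ν)
          ≤ B' * (2 * (σ * p.1) ^ κ) := by
            have e3 := Real.rpow_pos_of_pos hp ν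
            have e4 : 1 + ν - (1 - ν ^ 2) ≤ 2 := by nlinarith
            have e5 : 0 ≤ 1 + ν - (1 - ν ^ 2) := by nlinarith
            gcongr
        _ = 2 * B' * (σ * p.1) ^ κ := by ring
        _ ≤ M * (σ * p.1) ^ κ := by
          gcongr
          linarith
    · change |b p * _ + σ * pd 0 φ p * ((1 - ν - (1 - ν ^ 2)) * (σ * p.1) ^ (1 - ν - 1))| ≤ _
      have e0 := hEF _ hp
      rw [← hc] at e0
      rw [e0, show 1 - ν - 1 = -ν by ring]
      -- Since $1-\nu-(1-\nu^2)=-\nu(1-\nu)$, the coefficient `b` cancels the value of $\varphi_x$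
      -- on the circle. The remaining difference is $O(r)$, which improves $r^{-\nu}$ to
      -- $r^{1-\nu}$.
      have e1 : b p * (σ * p.1) ^ (-ν) + σ * pd 0 φ p * ((1 - ν - (1 - ν ^ 2)) * (σ * p.1) ^ (-ν))
          = -(σ * κ * (pd 0 φ p - pd 0 φ (0, p.2)) * (σ * p.1) ^ (-ν)) := by
        rw [hb, correctionCoeff, hκ]
        ring
      have hrν := Real.rpow_pos_of_pos hp (-ν)
      rw [e1, abs_neg, abs_mul, abs_mul, abs_mul, hσabs, one_mul, abs_of_pos hκ0, abs_of_pos hrν]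
      have e2 := hL p (habs p hp hp1)
      rw [abs_eq_mul hσ hp] at e2
      have e3 : (σ * p.1) ^ (1 - ν) ≤ (σ * p.1) ^ κ := hpow hp hp1 (by nlinarith)
      have e4 : (σ * p.1) ^ (1 - ν) = σ * p.1 * (σ * p.1) ^ (-ν) := by
        rw [sub_eq_add_neg, Real.rpow_add hp, Real.rpow_one]
      calc κ * |pd 0 φ p - pd 0 φ (0, p.2)| * (σ * p.1) ^ (-ν)
          ≤ 1 * (L * (σ * p.1)) * (σ * p.1) ^ (-ν) := by
            gcongr
            nlinarith
        _ = L * (σ * p.1) ^ (1 - ν) := by rw [e4]; ring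
        _ ≤ M * (σ * p.1) ^ κ := by
          gcongr
          linarith
  refine ⟨fun i => truncated σ δ (fun r => r ^ q i) F (β i), hL2,
    fun i => smoothOn_truncated (ha i) hF (hβ i) hσ, fun i => star_truncated, hE,
    fun i p hp => ⟨(tsupport_truncated hδ hp).1, (tsupport_truncated hδ hp).2.trans_lt hδε⟩, ?_⟩
  have hWle : ∀ p : Cylinder, 0 < σ * p.1 → σ * p.1 ≤ δ → |p.1| ≤ 1 ∧ |b p * (σ * p.1)| ≤ ν := by
    intro p hp hp'
    have hx := habs p hp (by linarith)
    refine ⟨hx, ?_⟩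
    rw [abs_mul, abs_of_pos hp]
    calc |b p| * (σ * p.1) ≤ B * δ := by
          have := hB p hx
          gcongr
      _ ≤ ν := hδB
  refine (metric φ hφ s).linearIndependent_mkQ s.isOpen_region c
    (fun i => smoothOn_truncated (ha i) hF (hβ i) hσ) hL2 hE
    (η := fun n p => radialCutoff n p.1)
    (fun n => ((contDiff_radialCutoff n).continuous.comp continuous_fst).measurable)
    (fun n p => abs_radialCutoff_le n _) (fun p hp => ?_)
    (fun i n => smul_truncated_mem hσ hσs hδ (ha i) hF (hβ i) n) ?_
  · refine tendsto_const_nhds.congr' ?_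
    filter_upwards [eventually_two_lt (Side.ne_zero hp)] with n hn
    rw [radialCutoff_eq_one hn.le]
  -- The powers have Wronskian $2\nu r$, and $r^{1+\nu}$ against $bF$ contributes $br^2$.
  -- Multiplying by the density $r^{-1}e^{-\varphi}$ gives `W`, and $|br|\le\nu$ puts $2\nu+br$
  -- between $\nu$ and $3\nu$.
  · refine pairing_ne_zero (W := fun p => Real.exp (-φ p) * (2 * ν + b p * (σ * p.1)))
      (m := Real.exp (-Bφ) * ν) (B := Real.exp Bφ * (3 * ν)) hφ hσ hσs hδ (ha 0) (ha 1) hF (hβ 0)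
      (hβ 1) (hβ0 0) (hβ0 1) c (hL2 0) (hL2 1) (hE 0) (hE 1) ?_ (by positivity)
      (fun p hp hp' => ?_) (fun p hp hp' => ?_) fun p hp hp' => ?_
    · have h1 := hφ.continuous
      have h2 := hbs.continuous
      fun_prop
    · obtain ⟨hx, hbp⟩ := hWle p hp hp'
      have h1 := (abs_le.mp hbp).1
      have h2 := le_of_abs_le (hBφ p hx)
      gcongr
      linarith
    · obtain ⟨hx, hbp⟩ := hWle p hp hp'
      have h1 := abs_le.mp hbp
      have h2 := (abs_le.mp (hBφ p hx)).1
      gcongr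
      · linarith
      · linarith
      · linarith [h1.2]
    · have hw := hWF _ hp
      simp only [ansatz]
      change (σ * p.1)⁻¹ * Real.exp (-φ p) *
        (((1 + ν) * (σ * p.1) ^ (1 + ν - 1) + 0 * F₁ (σ * p.1))
          * ((σ * p.1) ^ (1 - ν) + b p * F (σ * p.1))
        - ((σ * p.1) ^ (1 + ν) + 0 * F (σ * p.1))
          * ((1 - ν) * (σ * p.1) ^ (1 - ν - 1) + b p * F₁ (σ * p.1))) = _
      have hνp := (Real.rpow_pos_of_pos hp ν).ne'
      rw [show 1 + ν - 1 = ν by ring, show 1 - ν - 1 = -ν by ring, Real.rpow_sub hp,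
        Real.rpow_neg hp.le, Real.rpow_one]
      have e1 : (σ * p.1) ^ (1 + ν) * ((σ * p.1) ^ ν)⁻¹ = σ * p.1 := by
        rw [Real.rpow_add hp, Real.rpow_one]
        field_simp
      have e2 : (σ * p.1) ^ ν * (σ * p.1 / (σ * p.1) ^ ν) = σ * p.1 := by field_simp
      have e3 : (σ * p.1)⁻¹ * (σ * p.1) = 1 := inv_mul_cancel₀ hp.ne'
      linear_combination (σ * p.1)⁻¹ * Real.exp (-φ p) * ((1 + ν) * e2 - (1 - ν) * e1 + b p * hw)
        + Real.exp (-φ p) * (2 * ν + b p * (σ * p.1)) * e3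

end Pair

/-! ### Conclusion -/

/-- One half-cylinder inside $D'$ carries both functions; when $D'$ has two components the positive
one is chosen. -/
theorem Side.exists_half_subset (t : Side) : ∃ σ : ℝ, σ * σ = 1 ∧ half σ ⊆ t.region := by
  have h1 : ∀ p ∈ half 1, 0 < p.1 := fun p hp => by
    have : 0 < 1 * p.1 := hp
    linarith
  have h2 : ∀ p ∈ half (-1), p.1 < 0 := fun p hp => by
    have : 0 < -1 * p.1 := hp
    linarith
  cases t
  · exact ⟨1, by norm_num, h1⟩
  · exact ⟨-1, by norm_num, h2⟩
  · exact ⟨1, by norm_num, fun p hp => (h1 p hp).ne'⟩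

end Grushin

end

theorem theorem4p1 (φ : Grushin.Cylinder → ℝ) (hφ : Grushin.SmoothOn univ φ)
    (hφ_const : ∃ R : ℝ, ∀ (x x' : ℝ) (y : AddCircle (2 * Real.pi)),
      (R < x ∧ R < x') ∨ (x < -R ∧ x' < -R) → φ (x, y) = φ (x', y))
    (c : ℝ) (hc0 : 0 < c) (hc1 : c < 1 / 2) (s : Grushin.Side) :
    (∀ t : Grushin.Side, t.region ⊆ s.region → ∀ ε : ℝ, 0 < ε → ∃ (h : Fin 2 → Grushin.Cylinder → ℂ)
        (hL2 : ∀ i, MemLp (h i) 2 (Grushin.metric φ hφ s).vol),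
      (∀ i,
        Grushin.SmoothOn s.region (h i) ∧
        (hL2 i).toLp (h i) ∈ (Grushin.operator φ hφ s c).adjoint.domain ∧
        (hL2 i).toLp (h i) ∉ (Grushin.operator φ hφ s c).closure.domain ∧
        closure (Function.support (h i) ∩ s.region) ∩ s.region ⊆
          {p | p ∈ t.region ∧ |p.1| < ε}) ∧
      LinearIndependent ℂ (fun i =>
        (Grushin.operator φ hφ s c).closure.domain.mkQ ((hL2 i).toLp (h i)))) ∧
    ¬ IsSelfAdjoint (Grushin.operator φ hφ s c).closure := by
  -- The exponents $1\pm\nu$ are the roots of $(q-1)^2=1-2c$; $c<1/2$ makes them distinct and $c>0$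
  -- makes $1-\nu$ positive.
  obtain ⟨ν, hν0, hν1, hc⟩ : ∃ ν : ℝ, 0 < ν ∧ ν < 1 ∧ 2 * c = 1 - ν ^ 2 := by
    refine ⟨√(1 - 2 * c), Real.sqrt_pos.mpr (by linarith), ?_, ?_⟩
    · rw [Real.sqrt_lt' one_pos]
      linarith
    · rw [Real.sq_sqrt (by linarith)]
      ring
  -- The statement is strengthened by membership in the domain of the adjoint of the closure, which
  -- contradicts self-adjointness.
  have key : ∀ t : Grushin.Side, t.region ⊆ s.region → ∀ ε : ℝ, 0 < ε →
      ∃ (h : Fin 2 → Grushin.Cylinder → ℂ)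
        (hL2 : ∀ i, MemLp (h i) 2 (Grushin.metric φ hφ s).vol),
      (∀ i,
        Grushin.SmoothOn s.region (h i) ∧
        (hL2 i).toLp (h i) ∈ (Grushin.operator φ hφ s c).adjoint.domain ∧
        (hL2 i).toLp (h i) ∈ (Grushin.operator φ hφ s c).closure.adjoint.domain ∧
        (hL2 i).toLp (h i) ∉ (Grushin.operator φ hφ s c).closure.domain ∧
        closure (Function.support (h i) ∩ s.region) ∩ s.region ⊆
          {p | p ∈ t.region ∧ |p.1| < ε}) ∧
      LinearIndependent ℂ (fun i =>
        (Grushin.operator φ hφ s c).closure.domain.mkQ ((hL2 i).toLp (h i))) := by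
    intro t ht ε hε
    obtain ⟨σ, hσ, hσt⟩ := t.exists_half_subset
    obtain ⟨h, hL2, hsm, hstar, hE, hsupp, hli⟩ :=
      Grushin.exists_deficiency_pair hφ hσ (hσt.trans ht) hν0 hν1 hc hε
    refine ⟨h, hL2, fun i => ?_, hli⟩
    obtain ⟨had, had'⟩ := (Grushin.metric φ hφ s).mem_adjoint_domain s.isOpen_region c (hstar i)
      (hsm i) (hL2 i) (hE i)
    refine ⟨hsm i, had, had', fun hmem => hli.ne_zero i ?_, fun p hp => ?_⟩
    · rwa [Submodule.mkQ_apply, Submodule.Quotient.mk_eq_zero]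
    · have h1 := hsupp i (closure_mono inter_subset_left hp.1)
      have h2 : 0 < σ * p.1 := h1.1.lt_of_ne (Grushin.sign_mul_fst_ne_zero hσ hp.2).symm
      exact ⟨hσt h2, (Grushin.abs_eq_mul hσ h2).trans_lt h1.2⟩
  refine ⟨fun t ht ε hε => ?_, fun hsa => ?_⟩
  · obtain ⟨h, hL2, hall, hli⟩ := key t ht ε hε
    exact ⟨h, hL2, fun i => ⟨(hall i).1, (hall i).2.1, (hall i).2.2.2⟩, hli⟩
  · obtain ⟨h, hL2, hall, -⟩ := key s subset_rfl 1 one_pos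
    have hmem := (hall 0).2.2.1
    rw [LinearPMap.isSelfAdjoint_def.mp hsa] at hmem
    exact (hall 0).2.2.2.1 hmem
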